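/- Logarithms are to base $2$. Consider the binary substitution channel with noiseless feedback: the symbol $c_i\in\{0,1\}$ sent at time $i$ may depend on the message and on the symbols $y_1,\dots,y_{i-1}$ already received, and an adversary chooses the received word $y=(y_1,\dots,y_n)$, subject to at most $t$ indices $i$ with $c_i\neq y_i$. Let $M_s(n,t)$ be the maximal number of messages that some encoder and decoder can transmit in blocklength $n$ so that decoding is always correct against at most $t$ errors, and let $$R_s(\tau)=\limsup_{n\to\infty}\frac{\log M_s(n,\lfloor\tau n\rfloor)}{n}.$$ For $0<\alpha<1$ and $\beta=2-\alpha$, the algorithm $\mathfrak A_s(M,n,\alpha)$ works as follows. Divide $[0,1]$ into $M$ consecutive segments of length $1/M$, the $m$-th belonging to message $m\in\{1,\dots,M\}$. At each time the sender of message $m$ transmits $0$ if the centre of the current $m$-th segment is less than $\frac12$, and $1$ otherwise. If $0$ is received, the part of $[0,1]$ to the left of $\frac12$ is stretched by the factor $\beta$ and the part to the right is scaled by $\alpha$ (so the total length stays $1$), and all segments change accordingly, keeping their order; if $1$ is received, the roles of $\alpha$ and $\beta$ are exchanged. After $n$ symbols the receiver outputs the index of the segment that contains the point $\frac12$. Let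 $M_s(n,t,\alpha)$ be the maximal $M$ for which, for every message $m$ and every received word with at most $t$ errors, the $m$-th segment is at the end the only segment containing $\frac12$. **Proposition.** Let $\tau>0$ and $\alpha=\frac{2\tau}{1+\tau}\le\frac{3-\sqrt5}{2}$, with $\alpha$ and $\tau$ non-algebraic. Then, as $n\to\infty$, $$\min_{k\in\{0,1,\dots,\lfloor\tau n\rfloor\}}\log M_s\big(\lfloor n(1+\tau)\rfloor-2k,\ \lfloor\tau n\rfloor-k,\ \alpha\big)=(1+o(1))\,\log M_s\big(\lfloor n(1+\tau)\rfloor,\ \lfloor\tau n\rfloor,\ \alpha\big),$$ and both sides equal $$n(1+\tau)\,R_s\!\left(\frac{\tau}{1+\tau}\right)+o(n).$$ -/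

import Mathlib

open Filter Topology Asymptotics

noncomputable section

namespace FeedbackCoding

/-! ### The binary adversarial substitution channel with noiseless feedback

Symbols are Booleans (`false` is the symbol 0, `true` is the symbol 1).  A strategy for one fixed
message is a function `c : List Bool → Bool` giving the next symbol to send from the list of the
symbols received so far (in order of reception). -/

/-- The word sent by the strategy `c` when the received word is `y`: the symbol at position `i`
depends on the symbols of `y` at the positions before `i`. -/
def sentWord (c : List Bool → Bool) {n : ℕ} (y : Fin n → Bool) : Fin n → Bool :=
  fun i => c ((List.ofFn y).take i)

/-- `y` can be received when the strategy `c` is used and at most `t` symbols are substituted. -/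
def IsOutput (c : List Bool → Bool) {n : ℕ} (t : ℕ) (y : Fin n → Bool) : Prop :=
  hammingDist (sentWord c y) y ≤ t

/-- `M` messages can be transmitted in blocklength `n` with feedback, correcting any `t`
substitution errors, by some encoder and some decoder. -/
def Transmittable (n t M : ℕ) : Prop :=
  ∃ (enc : Fin M → List Bool → Bool) (dec : (Fin n → Bool) → Fin M),
    ∀ (m : Fin M) (y : Fin n → Bool), IsOutput (enc m) t y → dec y = m

/-- `M_s(n, t)`: the maximal number of messages of a feedback code of length `n` correcting `t`
substitution errors. -/
def maxMessages (n t : ℕ) : ℕ := sSup {M : ℕ | Transmittable n t M}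

/-- `R_s(τ)`: the maximal asymptotic rate of feedback codes that correct a fraction `τ` of
substitution errors. -/
def maxRate (τ : ℝ) : ℝ :=
  limsup (fun n : ℕ => Real.logb 2 (maxMessages n ⌊τ * n⌋₊ : ℝ) / (n : ℝ)) atTop

/-! ### The algorithm `𝔄_s(M, n, α)`

The unit interval is divided into `M` segments, one per message.  A segment is recorded as the pair
`(l, r)` of the total lengths of the parts of `[0, 1]` to its left and to its right, so that it is
the interval `[l, 1 - r]`.  Throughout, `β = 2 - α`. -/

/-- The initial segment of the message `m`: `[0, 1]` is cut into `M` segments of equal length. -/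
def initSegment (M : ℕ) (m : Fin M) : ℝ × ℝ :=
  ((m : ℝ) / M, ((M : ℝ) - 1 - m) / M)

/-- The update of a segment after the symbol `y` has been received: for the symbol 0 everything on
the left of `1/2` is scaled by `β = 2 - α` and everything on the right by `α`; for the symbol 1 the
two factors are exchanged. -/
def updateSegment (α : ℝ) (s : ℝ × ℝ) (y : Bool) : ℝ × ℝ :=
  if y = false then
    ((2 - α) * min (1 / 2) s.1 + α * max (s.1 - 1 / 2) 0,
      α * min (1 / 2) s.2 + (2 - α) * max (s.2 - 1 / 2) 0)
  else
    ((2 - α) * max (s.1 - 1 / 2) 0 + α * min (1 / 2) s.1,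
      α * max (s.2 - 1 / 2) 0 + (2 - α) * min (1 / 2) s.2)

/-- The segment of the message `m` after the symbols `ys` have been received. -/
def segmentAfter (α : ℝ) (M : ℕ) (m : Fin M) (ys : List Bool) : ℝ × ℝ :=
  ys.foldl (updateSegment α) (initSegment M m)

/-- The encoder of the algorithm: 0 is sent if the centre of the segment of `m` is less than `1/2`,
and 1 otherwise. -/
def algorithmEncoder (α : ℝ) (M : ℕ) (m : Fin M) (ys : List Bool) : Bool :=
  let s := segmentAfter α M m ys
  if s.1 + (1 - s.1 - s.2) / 2 < 1 / 2 then false else true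

/-- After `ys` has been received, the segment of the message `j` contains the point `1/2`. -/
def ContainsHalf (α : ℝ) (M : ℕ) (j : Fin M) (ys : List Bool) : Prop :=
  (1 / 2 : ℝ) ∈ Set.Icc (segmentAfter α M j ys).1 (1 - (segmentAfter α M j ys).2)

/-- The algorithm with parameters `M, n, α` succeeds against `t` substitution errors: whatever
message `m` is sent and whatever word `y` the channel outputs, the segment of `m`, and of no other
message, contains the point `1/2` at the end (this is how the message is decoded). -/
def AlgorithmSucceeds (n t : ℕ) (α : ℝ) (M : ℕ) : Prop :=
  ∀ (m : Fin M) (y : Fin n → Bool), IsOutput (algorithmEncoder α M m) t y →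
    ∀ j : Fin M, ContainsHalf α M j (List.ofFn y) ↔ j = m

/-- `M_s(n, t, α)`: the maximal number of messages that can successfully be transmitted by the
algorithm with parameter `α`, with blocklength `n` and at most `t` substitution errors. -/
def algorithmMaxMessages (n t : ℕ) (α : ℝ) : ℕ := sSup {M : ℕ | AlgorithmSucceeds n t α M}

/-- `log₂ M_s(⌊n(1+τ)⌋ - 2k, ⌊τn⌋ - k, α)`. -/
def logMessages (α τ : ℝ) (n k : ℕ) : ℝ :=
  Real.logb 2 (algorithmMaxMessages (⌊(n : ℝ) * (1 + τ)⌋₊ - 2 * k) (⌊τ * n⌋₊ - k) α : ℝ)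

/-- The minimum of `logMessages α τ n k` over `k ∈ {0, 1, …, ⌊τn⌋}`. -/
def minLogMessages (α τ : ℝ) (n : ℕ) : ℝ :=
  (Finset.range (⌊τ * n⌋₊ + 1)).inf' Finset.nonempty_range_add_one (logMessages α τ n)

end FeedbackCoding

end

noncomputable section

namespace FeedbackCoding

/-! ### One step of the algorithm -/

/-! Write `β = 2 - α`. Ideally a correct symbol multiplies the length of the sent segment by `β`,
while an error multiplies it by at least `α`. So `t` errors in `n` steps should be harmless as soon
as `log M < n log β - t (log β - log α)`, up to `o(n)`. At `t ≈ α n / 2` this meets the Hamming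
bound with feedback, which gives the rate (`maxRate_eq`) and the size of `logMessages` at `k = 0`.
Passing from `(n, t)` to `(n - 2, t - 1)` changes the lower bound by `-log (α β) > 0`, so no `k`
does worse than `k = 0` by more than `o(n)`.

The obstacle is a stall: a correct symbol received while `1/2` is interior to the segment stretches
one part and shrinks the other. `sideRatio` never increases, and a stall multiplies it by a fixed `q
< 1` unless it is close to 1, that is, unless both ends are close to `1/2`. Stalls of this
exceptional kind are rare: after a stall the segment carries along the image of `1/2`, which for
transcendental `α` keeps away from `1/2` for any bounded number of steps (`exists_return_gap`).
Hence only `o(N)` stalls occur before `sideRatio` drops to `α ^ 2 / 16` (`exists_card_stalls_le`).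

From then on `latePotential` replaces the length. It gains the full factor `β` at each correct
symbol and loses at most `α` at an error; this uses `α² - 3α + 1 ≥ 0`, which follows from `α ≤ (3 -
√5)/2`. A potential above `1/2` forces `1/2` to be interior, which is correct decoding. -/

/-- The pair `(l, r)` describes a segment of positive length that is not all of `[0, 1]`. -/
def Proper (s : ℝ × ℝ) : Prop := 0 ≤ s.1 ∧ 0 ≤ s.2 ∧ s.1 + s.2 < 1 ∧ 0 < s.1 + s.2

/-- The point `1/2` is in the interior of the segment. -/
def Straddles (s : ℝ × ℝ) : Prop := max s.1 s.2 < 1 / 2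

/-- The length of the segment. -/
def segLength (s : ℝ × ℝ) : ℝ := 1 - s.1 - s.2

/-- The symbol `y` stretches the half of `[0, 1]` that contains the centre of the segment. -/
def IsToward (s : ℝ × ℝ) (y : Bool) : Prop :=
  (y = false ∧ s.1 ≤ s.2) ∨ (y = true ∧ s.2 ≤ s.1)

/-- The symbol `y` shrinks the half of `[0, 1]` that contains the centre of the segment. -/
def IsAway (s : ℝ × ℝ) (y : Bool) : Prop :=
  (y = true ∧ s.1 ≤ s.2) ∨ (y = false ∧ s.2 ≤ s.1)

lemma isToward_or_isAway (s : ℝ × ℝ) (y : Bool) : IsToward s y ∨ IsAway s y := by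
  unfold IsToward IsAway
  rcases le_total s.1 s.2 with h | h <;> cases y <;> simp [h]

lemma updateSegment_swap (α : ℝ) (s : ℝ × ℝ) (y : Bool) :
    updateSegment α s.swap (!y) = (updateSegment α s y).swap := by
  cases y <;> simp [updateSegment, add_comm]

lemma Proper.swap {s : ℝ × ℝ} (h : Proper s) : Proper s.swap := by
  obtain ⟨h1, h2, h3, h4⟩ := h
  refine ⟨h2, h1, ?_, ?_⟩ <;> simp only [Prod.fst_swap, Prod.snd_swap] <;> linarith

/-- The outcome of stretching the half that contains the centre, when `l ≤ r`. -/
def towardPair (α l r : ℝ) : ℝ × ℝ :=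
  ((2 - α) * l, if r < 1 / 2 then α * r else 1 - (2 - α) * (1 - r))

/-- The outcome of shrinking the half that contains the centre, when `l ≤ r`. -/
def awayPair (α l r : ℝ) : ℝ × ℝ :=
  (α * l, if r < 1 / 2 then (2 - α) * r else 1 - α * (1 - r))

lemma updateSegment_false_eq {α l r : ℝ} (h : Proper (l, r)) (hlr : l ≤ r) :
    updateSegment α (l, r) false = towardPair α l r := by
  obtain ⟨h1, h2, h3, h4⟩ := h
  simp only at h1 h2 h3 h4
  have hl : l ≤ 1 / 2 := by linarith
  unfold updateSegment towardPair
  rw [if_pos rfl]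
  ext
  · simp only
    rw [min_eq_right hl, max_eq_right (by linarith)]; ring
  · simp only
    split_ifs with hr
    · rw [min_eq_right hr.le, max_eq_right (by linarith)]; ring
    · rw [min_eq_left (by linarith), max_eq_left (by linarith)]; ring

lemma updateSegment_true_eq {α l r : ℝ} (h : Proper (l, r)) (hlr : l ≤ r) :
    updateSegment α (l, r) true = awayPair α l r := by
  obtain ⟨h1, h2, h3, h4⟩ := h
  simp only at h1 h2 h3 h4
  have hl : l ≤ 1 / 2 := by linarith
  unfold updateSegment awayPair
  rw [if_neg (by simp)]
  ext
  · simp only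
    rw [min_eq_right hl, max_eq_right (by linarith)]; ring
  · simp only
    split_ifs with hr
    · rw [min_eq_right hr.le, max_eq_right (by linarith)]; ring
    · rw [min_eq_left (by linarith), max_eq_left (by linarith)]; ring

/-- The reflection `x ↦ 1 - x` swaps the two sides and the two symbols, so a symmetric claim need
only be checked for `l ≤ r`, where the update is explicit. -/
lemma IsToward.induction {α : ℝ} {motive : ℝ × ℝ → ℝ × ℝ → Prop}
    (hsymm : ∀ s s', motive s s' → motive s.swap s'.swap)
    (h : ∀ l r, Proper (l, r) → l ≤ r → motive (l, r) (towardPair α l r))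
    {s : ℝ × ℝ} {y : Bool} (hs : Proper s) (hy : IsToward s y) :
    motive s (updateSegment α s y) := by
  obtain ⟨l, r⟩ := s
  rcases hy with ⟨rfl, hlr⟩ | ⟨rfl, hlr⟩
  · rw [updateSegment_false_eq hs hlr]; exact h l r hs hlr
  · have := hsymm _ _ (h r l hs.swap hlr)
    rw [← updateSegment_false_eq hs.swap hlr, ← updateSegment_swap] at this
    simpa using this

lemma IsAway.induction {α : ℝ} {motive : ℝ × ℝ → ℝ × ℝ → Prop}
    (hsymm : ∀ s s', motive s s' → motive s.swap s'.swap)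
    (h : ∀ l r, Proper (l, r) → l ≤ r → motive (l, r) (awayPair α l r))
    {s : ℝ × ℝ} {y : Bool} (hs : Proper s) (hy : IsAway s y) :
    motive s (updateSegment α s y) := by
  obtain ⟨l, r⟩ := s
  rcases hy with ⟨rfl, hlr⟩ | ⟨rfl, hlr⟩
  · rw [updateSegment_true_eq hs hlr]; exact h l r hs hlr
  · have := hsymm _ _ (h r l hs.swap hlr)
    rw [← updateSegment_true_eq hs.swap hlr, ← updateSegment_swap] at this
    simpa using this

lemma Proper.update {α : ℝ} (h0 : 0 < α) (h1 : α < 1) {s : ℝ × ℝ} (hs : Proper s) (y : Bool) :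
    Proper (updateSegment α s y) := by
  rcases isToward_or_isAway s y with hy | hy
  · refine IsToward.induction (motive := fun _ s' => Proper s') (fun _ _ h => h.swap) ?_ hs hy
    rintro l r ⟨hl, hr, hlr, hlr'⟩ hle
    simp only at hl hr hlr hlr'
    have hr' : 0 < r := by linarith
    unfold towardPair
    split_ifs with h
    · refine ⟨?_, ?_, ?_, ?_⟩ <;> simp only <;> nlinarith
    · refine ⟨?_, ?_, ?_, ?_⟩ <;> simp only <;> nlinarith
  · refine IsAway.induction (motive := fun _ s' => Proper s') (fun _ _ h => h.swap) ?_ hs hy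
    rintro l r ⟨hl, hr, hlr, hlr'⟩ hle
    simp only at hl hr hlr hlr'
    have hr' : 0 < r := by linarith
    unfold awayPair
    split_ifs with h
    · refine ⟨?_, ?_, ?_, ?_⟩ <;> simp only <;> nlinarith
    · refine ⟨?_, ?_, ?_, ?_⟩ <;> simp only <;> nlinarith

lemma straddles_swap {s : ℝ × ℝ} : Straddles s.swap ↔ Straddles s := by
  simp [Straddles, max_comm]

lemma segLength_swap (s : ℝ × ℝ) : segLength s.swap = segLength s := by
  simp [segLength]; ring

/-! ### Length and side ratio in one step -/

lemma IsToward.segLength_update {α : ℝ} {s : ℝ × ℝ} {y : Bool} (hs : Proper s)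
    (hy : IsToward s y) (hS : ¬ Straddles s) :
    segLength (updateSegment α s y) = (2 - α) * segLength s := by
  revert hS
  refine IsToward.induction
    (motive := fun s s' => ¬ Straddles s → segLength s' = (2 - α) * segLength s) ?_ ?_ hs hy
  · intro s s' h; simpa only [straddles_swap, segLength_swap] using h
  · intro l r h hle hS
    have hr : ¬ r < 1 / 2 := by simpa [Straddles, max_eq_right hle] using hS
    simp only [segLength, towardPair, if_neg hr]; ring

/-- For `l ≤ r` the length changes by `(1 - α)(r - l)`, so a stall gains possibly nothing but never
loses. -/
lemma IsToward.segLength_le_update {α : ℝ} (h1 : α < 1) {s : ℝ × ℝ} {y : Bool} (hs : Proper s)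
    (hy : IsToward s y) (hS : Straddles s) :
    segLength s ≤ segLength (updateSegment α s y) := by
  revert hS
  refine IsToward.induction
    (motive := fun s s' => Straddles s → segLength s ≤ segLength s') ?_ ?_ hs hy
  · intro s s' h; simpa only [straddles_swap, segLength_swap] using h
  · intro l r h hle hS
    have hr : r < 1 / 2 := by simpa [Straddles, max_eq_right hle] using hS
    simp only [segLength, towardPair, if_pos hr]; nlinarith

lemma IsAway.segLength_le_update {α : ℝ} (h1 : α < 1) {s : ℝ × ℝ} {y : Bool} (hs : Proper s)
    (hy : IsAway s y) :
    α * segLength s ≤ segLength (updateSegment α s y) := by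
  refine IsAway.induction
    (motive := fun s s' => α * segLength s ≤ segLength s') ?_ ?_ hs hy
  · intro s s' h; simpa only [segLength_swap] using h
  · intro l r h hle
    simp only [segLength, awayPair]
    split_ifs with hr <;> nlinarith

/-- A quantity that no update increases. -/
def sideRatio (s : ℝ × ℝ) : ℝ :=
  if max s.1 s.2 < 1 / 2 then 4 * (s.1 * s.2) else min s.1 s.2 / (1 - max s.1 s.2)

lemma sideRatio_swap (s : ℝ × ℝ) : sideRatio s.swap = sideRatio s := by
  simp [sideRatio, max_comm, min_comm, mul_comm]

lemma sideRatio_of_le {l r : ℝ} (h : l ≤ r) :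
    sideRatio (l, r) = if r < 1 / 2 then 4 * (l * r) else l / (1 - r) := by
  simp [sideRatio, max_eq_right h, min_eq_left h]

lemma sideRatio_of_ge {l r : ℝ} (h : r ≤ l) :
    sideRatio (l, r) = if l < 1 / 2 then 4 * (l * r) else r / (1 - l) := by
  simp [sideRatio, max_eq_left h, min_eq_right h]

lemma sideRatio_of_lt {l r : ℝ} (hl : l < 1 / 2) (hr : r < 1 / 2) :
    sideRatio (l, r) = 4 * (l * r) := by
  simp only [sideRatio]
  rw [if_pos (max_lt hl hr)]

/-- While `1/2` is interior, `l r` is multiplied by `α β < 1`; while the segment lies in one half,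
`l` and `1 - r` scale alike and their ratio is invariant. Where the formula changes, quadratic
inequalities suffice. -/
lemma IsToward.sideRatio_update_le {α : ℝ} (h0 : 0 < α) (h1 : α < 1) {s : ℝ × ℝ} {y : Bool}
    (hs : Proper s) (hy : IsToward s y) : sideRatio (updateSegment α s y) ≤ sideRatio s := by
  refine IsToward.induction
    (motive := fun s s' => sideRatio s' ≤ sideRatio s) ?_ ?_ hs hy
  · intro s s' h; simpa only [sideRatio_swap] using h
  · rintro l r ⟨hl, hr, hlr, hlr'⟩ hle
    simp only at hl hr hlr hlr'
    rw [sideRatio_of_le hle]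
    unfold towardPair
    split_ifs with h
    · rcases lt_or_ge ((2 - α) * l) (1 / 2) with h' | h'
      · rw [sideRatio_of_lt h' (by nlinarith)]
        nlinarith [mul_nonneg hl hr, sq_nonneg (1 - α)]
      · rw [sideRatio_of_ge (by nlinarith), if_neg (by linarith), div_le_iff₀ (by nlinarith)]
        -- The difference of the two sides is `(1 - 2l)(2βl - α)`.
        have : α ≤ 4 * l * (1 - (2 - α) * l) := by
          nlinarith [mul_nonneg (show 0 ≤ 1 - 2 * l by linarith)
            (show 0 ≤ 2 * (2 - α) * l - α by nlinarith)]
        nlinarith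
    · have hx : 0 < 1 - r := by linarith
      rcases lt_or_ge (1 - (2 - α) * (1 - r)) (1 / 2) with h' | h'
      · have hx' : 1 - r ≤ 1 / 2 := by linarith
        rcases lt_or_ge ((2 - α) * l) (1 / 2) with hl2 | hl2
        · rw [sideRatio_of_lt hl2 h', le_div_iff₀ hx]
          have : 4 * ((2 - α) * (1 - r) * (1 - (2 - α) * (1 - r))) ≤ 1 := by
            nlinarith [sq_nonneg (2 * ((2 - α) * (1 - r)) - 1)]
          nlinarith
        · have hlu : l < 1 - r := by linarith
          rw [sideRatio_of_ge (by linarith), if_neg (by linarith),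
            div_le_div_iff₀ (by nlinarith) hx]
          nlinarith [mul_nonneg (show 0 ≤ 1 - r - l by linarith)
            (show 0 ≤ (2 - α) * (1 - r + l) - 1 by nlinarith)]
      · rw [sideRatio_of_le (by nlinarith), if_neg (by linarith),
          show 1 - (1 - (2 - α) * (1 - r)) = (2 - α) * (1 - r) by ring,
          mul_div_mul_left _ _ (by linarith)]

lemma IsAway.sideRatio_update_le {α : ℝ} (h0 : 0 < α) (h1 : α < 1) {s : ℝ × ℝ} {y : Bool}
    (hs : Proper s) (hy : IsAway s y) : sideRatio (updateSegment α s y) ≤ sideRatio s := by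
  refine IsAway.induction
    (motive := fun s s' => sideRatio s' ≤ sideRatio s) ?_ ?_ hs hy
  · intro s s' h; simpa only [sideRatio_swap] using h
  · rintro l r ⟨hl, hr, hlr, hlr'⟩ hle
    simp only at hl hr hlr hlr'
    rw [sideRatio_of_le hle]
    unfold awayPair
    split_ifs with h
    · rcases lt_or_ge ((2 - α) * r) (1 / 2) with h' | h'
      · rw [sideRatio_of_lt (by nlinarith) h']
        nlinarith [mul_nonneg hl hr, sq_nonneg (1 - α)]
      · rw [sideRatio_of_le (by nlinarith), if_neg (by linarith), div_le_iff₀ (by nlinarith)]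
        have : α ≤ 4 * r * (1 - (2 - α) * r) := by
          nlinarith [mul_nonneg (show 0 ≤ 1 - 2 * r by linarith)
            (show 0 ≤ 2 * (2 - α) * r - α by nlinarith)]
        nlinarith
    · rw [sideRatio_of_le (by nlinarith), if_neg (by nlinarith),
          show 1 - (1 - α * (1 - r)) = α * (1 - r) by ring,
          mul_div_mul_left _ _ (by linarith)]

lemma sideRatio_update_le {α : ℝ} (h0 : 0 < α) (h1 : α < 1) {s : ℝ × ℝ} (hs : Proper s)
    (y : Bool) : sideRatio (updateSegment α s y) ≤ sideRatio s :=
  (isToward_or_isAway s y).elim (fun h => h.sideRatio_update_le h0 h1 hs)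
    (fun h => h.sideRatio_update_le h0 h1 hs)

lemma sideRatio_le_one {s : ℝ × ℝ} (hs : Proper s) : sideRatio s ≤ 1 := by
  obtain ⟨hl, hr, hlr, -⟩ := hs
  unfold sideRatio
  split_ifs with h
  · nlinarith [(max_lt_iff.1 h).1, (max_lt_iff.1 h).2]
  · rw [div_le_one (sub_pos.2 (max_lt (by linarith) (by linarith)))]
    have := min_add_max s.1 s.2
    linarith

/-- The factor is `αβ` if `1/2` stays interior and `α / (4l(1 - βl))` otherwise. The latter
approaches 1 only as `l → 1/2`, which is excluded by `4l² ≤ 4lr ≤ 4c²`. -/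
lemma IsToward.sideRatio_update_le_mul {α c q : ℝ} (h0 : 0 < α) (h1 : α < 1) {s : ℝ × ℝ}
    {y : Bool} (hs : Proper s) (hy : IsToward s y) (hS : Straddles s)
    (hc : c < 1 / 2) (hK : sideRatio s ≤ 4 * c ^ 2) (hc0 : 0 < c)
    (hq1 : α * (2 - α) ≤ q) (hq2 : α ≤ q * (4 * c * (1 - (2 - α) * c))) :
    sideRatio (updateSegment α s y) ≤ q * sideRatio s := by
  revert hS hK
  refine IsToward.induction (motive := fun s s' => Straddles s → sideRatio s ≤ 4 * c ^ 2 →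
    sideRatio s' ≤ q * sideRatio s) ?_ ?_ hs hy
  · intro s s' h; simpa only [straddles_swap, sideRatio_swap] using h
  · rintro l r ⟨hl, hr, hlr, hlr'⟩ hle hS hK
    simp only at hl hr hlr hlr'
    have h : r < 1 / 2 := by simpa [Straddles, max_eq_right hle] using hS
    rw [sideRatio_of_le hle, if_pos h] at hK ⊢
    have hq0 : 0 < q := lt_of_lt_of_le (by nlinarith) hq1
    have hlc : l ≤ c := by nlinarith
    simp only [towardPair, if_pos h]
    rcases lt_or_ge ((2 - α) * l) (1 / 2) with h' | h'
    · rw [sideRatio_of_lt h' (by nlinarith)]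
      nlinarith [mul_nonneg hl hr]
    · rw [sideRatio_of_ge (by nlinarith), if_neg (by linarith), div_le_iff₀ (by nlinarith)]
      have h2 : 4 * c * (1 - (2 - α) * c) ≤ 4 * l * (1 - (2 - α) * l) := by
        nlinarith [mul_nonneg (show 0 ≤ c - l by linarith)
          (show 0 ≤ (2 - α) * (c + l) - 1 by nlinarith)]
      have h3 : α ≤ q * (4 * l * (1 - (2 - α) * l)) :=
        hq2.trans (mul_le_mul_of_nonneg_left h2 hq0.le)
      nlinarith

lemma half_sideRatio_le_of_straddles {s : ℝ × ℝ} {c : ℝ} (hs : Proper s) (hS : Straddles s)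
    (hc : c ≤ sideRatio s) : c / 2 ≤ s.1 ∧ c / 2 ≤ s.2 := by
  obtain ⟨hl, hr, -, -⟩ := hs
  have hS' := max_lt_iff.1 hS
  rw [sideRatio, if_pos (show max s.1 s.2 < 1 / 2 from hS)] at hc
  constructor <;> nlinarith

/-! ### A potential for segments with a small side ratio -/

/-- A potential that grows by the factor `2 - α` with every correct symbol and loses at most the
factor `α` with every error, as long as `sideRatio` is small. -/
def latePotential (α : ℝ) (s : ℝ × ℝ) : ℝ :=
  if max s.1 s.2 < 1 / 2 then
    1 / (8 * (max s.1 s.2 * max ((2 - α) / α * min s.1 s.2) (max s.1 s.2)))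
  else 1 - max s.1 s.2

lemma latePotential_swap (α : ℝ) (s : ℝ × ℝ) : latePotential α s.swap = latePotential α s := by
  simp [latePotential, max_comm, min_comm]

lemma latePotential_le_half {α : ℝ} {s : ℝ × ℝ} (h : ¬ Straddles s) :
    latePotential α s ≤ 1 / 2 := by
  unfold Straddles at h
  rw [latePotential, if_neg h]
  linarith

lemma latePotential_of_lt_of_le {α l r : ℝ} (hle : l ≤ r) (hr : r < 1 / 2) :
    latePotential α (l, r) = 1 / (8 * (r * max ((2 - α) / α * l) r)) := by
  simp only [latePotential, max_eq_right hle, min_eq_left hle, if_pos hr]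

lemma latePotential_of_lt_of_ge {α l r : ℝ} (hle : r ≤ l) (hr : l < 1 / 2) :
    latePotential α (l, r) = 1 / (8 * (l * max ((2 - α) / α * r) l)) := by
  simp only [latePotential, max_eq_left hle, min_eq_right hle, if_pos hr]

lemma latePotential_of_small {α l r : ℝ} (h0 : 0 < α) (h1 : α < 1) (hl : 0 ≤ l)
    (hle : (2 - α) * l ≤ α * r) (hr : r < 1 / 2) :
    latePotential α (l, r) = 1 / (8 * (r * r)) := by
  rw [latePotential_of_lt_of_le (by nlinarith) hr, max_eq_right]
  rw [div_mul_eq_mul_div, div_le_iff₀ h0]; linarith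

lemma latePotential_of_ge {α l r : ℝ} (hle : l ≤ r) (hr : 1 / 2 ≤ r) :
    latePotential α (l, r) = 1 - r := by
  simp only [latePotential, max_eq_right hle, if_neg (not_lt.2 hr)]

/-- The price of switching from length to potential is a constant factor, paid once. -/
lemma le_latePotential {α : ℝ} (h0 : 0 < α) (h1 : α < 1) {s : ℝ × ℝ} (hs : Proper s) :
    α / (2 * (2 - α)) * segLength s ≤ latePotential α s := by
  obtain ⟨hl, hr, hlr, hlr'⟩ := hs
  have hc : α / (2 * (2 - α)) ≤ 1 := by rw [div_le_one (by linarith)]; linarith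
  have hc0 : 0 ≤ α / (2 * (2 - α)) := div_nonneg h0.le (by linarith)
  have hx : segLength s ≤ 1 := by unfold segLength; linarith
  have hx0 : 0 ≤ segLength s := by unfold segLength; linarith
  unfold latePotential
  split_ifs with h
  · have hM : 0 < max s.1 s.2 := by
      have := le_max_left s.1 s.2
      have := le_max_right s.1 s.2
      linarith
    have hm : min s.1 s.2 ≤ max s.1 s.2 := min_le_max
    have hm0 : 0 ≤ min s.1 s.2 := le_min hl hr
    have h4 : max ((2 - α) / α * min s.1 s.2) (max s.1 s.2) ≤ (2 - α) / α * (1 / 2) := by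
      have h5 : 1 ≤ (2 - α) / α := by rw [one_le_div h0]; linarith
      apply max_le
      · gcongr; linarith
      · nlinarith
    have h6 : 0 < (2 - α) / α := div_pos (by linarith) h0
    have h5 : 0 < max ((2 - α) / α * min s.1 s.2) (max s.1 s.2) := lt_max_of_lt_right hM
    calc α / (2 * (2 - α)) * segLength s ≤ α / (2 * (2 - α)) * 1 := by gcongr
      _ = 1 / (8 * (1 / 2 * ((2 - α) / α * (1 / 2)))) := by
        have : 2 - α ≠ 0 := by linarith
        field_simp; norm_num
      _ ≤ _ := by gcongr
  · have := min_add_max s.1 s.2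
    have hm0 : 0 ≤ min s.1 s.2 := le_min hl hr
    have : segLength s ≤ 1 - max s.1 s.2 := by unfold segLength; linarith
    nlinarith

/-- With `u = 2v - 1`, `8v(1 - v)² = (1 + u)(1 - u)² = 1 - u(1 + u - u²)`. This is the case in which
a correct symbol brings `1/2` into the segment. -/
lemma le_one_div_mul_one_sub_sq {v : ℝ} (h : 1 / 2 ≤ v) (h' : v < 1) :
    v ≤ 1 / (8 * ((1 - v) * (1 - v))) := by
  have h1 : 0 < 1 - v := by linarith
  rw [le_div_iff₀ (by positivity)]
  nlinarith [mul_nonneg (show 0 ≤ 2 * v - 1 by linarith)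
    (show 0 ≤ 1 + (2 * v - 1) - (2 * v - 1) ^ 2 by nlinarith)]

/-- While `1/2` is interior, the product in the denominator is multiplied by at most `αβ`, and
`1/(αβ) ≥ β`. The weight `β/α` on the smaller side keeps this true when the sides exchange their
order. -/
lemma IsToward.mul_latePotential_le {α : ℝ} (h0 : 0 < α) (h1 : α < 1)
    (hα : 0 ≤ α ^ 2 - 3 * α + 1) {s : ℝ × ℝ} {y : Bool} (hs : Proper s) (hy : IsToward s y)
    (hK : sideRatio s ≤ α ^ 2 / 16) :
    (2 - α) * latePotential α s ≤ latePotential α (updateSegment α s y) := by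
  revert hK
  refine IsToward.induction (motive := fun s s' => sideRatio s ≤ α ^ 2 / 16 →
    (2 - α) * latePotential α s ≤ latePotential α s') ?_ ?_ hs hy
  · intro s s' h; simpa only [latePotential_swap, sideRatio_swap] using h
  · rintro l r ⟨hl, hr, hlr, hlr'⟩ hle hK
    simp only at hl hr hlr hlr'
    have hr0 : 0 < r := by linarith
    -- `1 - αβ² = (1 - α)(α² - 3α + 1)`.
    have hg : α * (2 - α) ^ 2 ≤ 1 := by nlinarith [mul_nonneg (sub_nonneg.2 h1.le) hα]
    rw [sideRatio_of_le hle] at hK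
    have hb : 0 < 2 - α := by linarith
    by_cases h : r < 1 / 2
    · rw [if_pos h] at hK
      have hl' : (2 - α) * l < 1 / 2 := by
        by_contra! hh
        nlinarith
      simp only [towardPair, if_pos h]
      have hM : 0 < max ((2 - α) / α * l) r := lt_max_of_lt_right hr0
      rw [latePotential_of_lt_of_le hle h, mul_one_div]
      have key : ∀ D : ℝ, 0 < D → D ≤ α * (2 - α) * (r * max ((2 - α) / α * l) r) →
          (2 - α) / (8 * (r * max ((2 - α) / α * l) r)) ≤ 1 / (8 * D) := by
        intro D hD hD'
        rw [div_le_div_iff₀ (by positivity) (by positivity)]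
        have : (2 - α) * D ≤ (2 - α) * (α * (2 - α) * (r * max ((2 - α) / α * l) r)) := by gcongr
        nlinarith [mul_pos hr0 hM]
      have e1 : r ≤ max ((2 - α) / α * l) r := le_max_right _ _
      have e2 : (2 - α) * l ≤ α * max ((2 - α) / α * l) r := by
        have := mul_le_mul_of_nonneg_left (le_max_left ((2 - α) / α * l) r) h0.le
        have e : α * ((2 - α) / α * l) = (2 - α) * l := by field_simp
        linarith
      rcases le_total ((2 - α) * l) (α * r) with h' | h'
      · rw [latePotential_of_lt_of_le h' (by nlinarith)]
        apply key
        · have : 0 < α * r := by positivity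
          exact mul_pos this (lt_max_of_lt_right this)
        · rw [show α * (2 - α) * (r * max ((2 - α) / α * l) r) =
            α * r * ((2 - α) * max ((2 - α) / α * l) r) by ring]
          gcongr
          apply max_le
          · rw [show (2 - α) / α * ((2 - α) * l) = (2 - α) * ((2 - α) / α * l) by ring]
            gcongr; exact le_max_left _ _
          · nlinarith
      · have hl0 : 0 < l := by
          have : 0 < α * r := by positivity
          by_contra! hh; nlinarith
        rw [latePotential_of_lt_of_ge h' hl']
        apply key
        · have : 0 < (2 - α) * l := by positivity
          exact mul_pos this (lt_max_of_lt_right this)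
        · rw [mul_max_of_nonneg _ _ (by positivity : 0 ≤ (2 - α) * l)]
          apply max_le
          · rw [show (2 - α) * l * ((2 - α) / α * (α * r)) = ((2 - α) * r) * ((2 - α) * l) by
              field_simp,
              show α * (2 - α) * (r * max ((2 - α) / α * l) r) =
                ((2 - α) * r) * (α * max ((2 - α) / α * l) r) by ring]
            gcongr
          · have : (2 - α) * l ≤ (2 - α) * r := by gcongr
            calc (2 - α) * l * ((2 - α) * l)
                ≤ (2 - α) * r * (α * max ((2 - α) / α * l) r) := by gcongr
              _ = _ := by ring
    · rw [if_neg h] at hK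
      push Not at h
      have hx : 0 < 1 - r := by linarith
      rw [div_le_iff₀ hx] at hK
      simp only [towardPair, if_neg (not_lt.2 h)]
      rw [latePotential_of_ge hle h]
      rcases lt_or_ge (1 - (2 - α) * (1 - r)) (1 / 2) with h' | h'
      -- The long side is still at least `α/2`, so a side ratio below `α²/16` makes the short side
      -- irrelevant to the maximum in the denominator.
      · have hge : α / 2 ≤ 1 - (2 - α) * (1 - r) := by nlinarith
        have hll : (2 - α) * l ≤ α ^ 2 / 16 := by nlinarith
        rw [latePotential_of_small h0 h1 (by positivity) _ h']
        · exact le_one_div_mul_one_sub_sq (by linarith) (by linarith)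
        · nlinarith
      · rw [latePotential_of_ge (by nlinarith) h']
        linarith

lemma IsAway.mul_latePotential_le {α : ℝ} (h0 : 0 < α) (h1 : α < 1)
    (hα : 0 ≤ α ^ 2 - 3 * α + 1) {s : ℝ × ℝ} {y : Bool} (hs : Proper s) (hy : IsAway s y)
    (hK : sideRatio s ≤ α ^ 2 / 16) :
    α * latePotential α s ≤ latePotential α (updateSegment α s y) := by
  revert hK
  refine IsAway.induction (motive := fun s s' => sideRatio s ≤ α ^ 2 / 16 →
    α * latePotential α s ≤ latePotential α s') ?_ ?_ hs hy
  · intro s s' h; simpa only [latePotential_swap, sideRatio_swap] using h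
  · rintro l r ⟨hl, hr, hlr, hlr'⟩ hle hK
    simp only at hl hr hlr hlr'
    have hr0 : 0 < r := by linarith
    have hg : α * (2 - α) ^ 2 ≤ 1 := by nlinarith [mul_nonneg (sub_nonneg.2 h1.le) hα]
    rw [sideRatio_of_le hle] at hK
    have hb : 0 < 2 - α := by linarith
    by_cases h : r < 1 / 2
    · rw [if_pos h] at hK
      simp only [awayPair, if_pos h]
      rcases lt_or_ge ((2 - α) * r) (1 / 2) with h' | h'
      · have hlr2 : α * l ≤ (2 - α) * r := by nlinarith
        have e : (2 - α) / α * (α * l) ≤ (2 - α) * r := by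
          rw [div_mul_eq_mul_div, div_le_iff₀ h0]; nlinarith [mul_pos hb h0]
        rw [latePotential_of_lt_of_le hlr2 h', max_eq_right e,
          latePotential_of_lt_of_le hle h, mul_one_div]
        have hM : 0 < max ((2 - α) / α * l) r := lt_max_of_lt_right hr0
        rw [div_le_div_iff₀ (by positivity) (by positivity)]
        have : r * r ≤ r * max ((2 - α) / α * l) r := by gcongr; exact le_max_right _ _
        have : α * (2 - α) ^ 2 * (r * r) ≤ 1 * (r * r) := by gcongr
        linarith
      · have hsm : (2 - α) * l ≤ α * r := by
          have hb2 : (2 - α) ^ 2 ≤ 4 := by nlinarith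
          have hlr0 := mul_nonneg hl hr
          have e2 : (2 - α) ^ 2 * (2 - α) * (l * r) ≤ 4 * 2 * (l * r) := by
            gcongr; linarith
          have h3 : 1 / 4 ≤ ((2 - α) * r) ^ 2 := by nlinarith
          have h3' : α * (1 / 4) ≤ α * ((2 - α) * r) ^ 2 := by gcongr
          have h4 : 0 ≤ ((2 - α) ^ 2 * r) * (α * r - (2 - α) * l) := by nlinarith
          exact sub_nonneg.1 (nonneg_of_mul_nonneg_right h4 (by positivity))
        rw [latePotential_of_small h0 h1 hl hsm h, latePotential_of_ge (by nlinarith) h',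
          mul_one_div, div_le_iff₀ (by positivity)]
        -- Multiplied by `β`, this is a quadratic in `βr ≥ 1/2` whose value at `βr = 1/2` is exactly
        -- `α² - 3α + 1`. Below, `8r²(1 - βr) - α` factors as `1 - 2r` times it.
        have h5 : 0 ≤ 4 * (2 - α) * r ^ 2 - 2 * α * r - α := by
          have h6 : 0 ≤ (2 - α) * (4 * (2 - α) * r ^ 2 - 2 * α * r - α) := by
            nlinarith
          exact nonneg_of_mul_nonneg_right h6 hb
        nlinarith [mul_nonneg (show 0 ≤ 1 - 2 * r by linarith) h5]
    · push Not at h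
      simp only [awayPair, if_neg (not_lt.2 h)]
      rw [latePotential_of_ge hle h, latePotential_of_ge (by nlinarith) (by nlinarith)]
      linarith

/-! ### Orbits of segments and of the point `1/2` -/

/-- The segments that arise from `s` when the symbols `w 0, w 1, …` are received. -/
def orbit (α : ℝ) (s : ℝ × ℝ) (w : ℕ → Bool) : ℕ → ℝ × ℝ
  | 0 => s
  | i + 1 => updateSegment α (orbit α s w i) (w i)

lemma orbit_add (α : ℝ) (s : ℝ × ℝ) (w : ℕ → Bool) (i k : ℕ) :
    orbit α s w (i + k) = orbit α (orbit α s w i) (fun j => w (i + j)) k := by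
  induction k with
  | zero => rfl
  | succ k ih => rw [← add_assoc, orbit, orbit, ih]

lemma Proper.orbit {α : ℝ} (h0 : 0 < α) (h1 : α < 1) {s : ℝ × ℝ} (hs : Proper s) (w : ℕ → Bool)
    (i : ℕ) : Proper (orbit α s w i) := by
  induction i with
  | zero => exact hs
  | succ i ih => exact ih.update h0 h1 _

lemma updateSegment_fst_mono {α : ℝ} (h0 : 0 < α) (h1 : α < 1) {s s' : ℝ × ℝ} (y : Bool)
    (h : s.1 ≤ s'.1) : (updateSegment α s y).1 ≤ (updateSegment α s' y).1 := by
  have : 0 ≤ 2 - α := by linarith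
  cases y <;> simp only [updateSegment, if_true, Bool.true_eq_false, if_false] <;> gcongr

lemma updateSegment_snd_mono {α : ℝ} (h0 : 0 < α) (h1 : α < 1) {s s' : ℝ × ℝ} (y : Bool)
    (h : s.2 ≤ s'.2) : (updateSegment α s y).2 ≤ (updateSegment α s' y).2 := by
  have : 0 ≤ 2 - α := by linarith
  cases y <;> simp only [updateSegment, if_true, Bool.true_eq_false, if_false] <;> gcongr

lemma orbit_fst_mono {α : ℝ} (h0 : 0 < α) (h1 : α < 1) {s s' : ℝ × ℝ} (w : ℕ → Bool)
    (h : s.1 ≤ s'.1) (i : ℕ) : (orbit α s w i).1 ≤ (orbit α s' w i).1 := by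
  induction i with
  | zero => exact h
  | succ i ih => exact updateSegment_fst_mono h0 h1 _ ih

lemma orbit_snd_mono {α : ℝ} (h0 : 0 < α) (h1 : α < 1) {s s' : ℝ × ℝ} (w : ℕ → Bool)
    (h : s.2 ≤ s'.2) (i : ℕ) : (orbit α s w i).2 ≤ (orbit α s' w i).2 := by
  induction i with
  | zero => exact h
  | succ i ih => exact updateSegment_snd_mono h0 h1 _ ih

/-- A pair with sum 1 is a degenerate segment, that is, a point. -/
lemma updateSegment_of_add_eq_one (α : ℝ) {s : ℝ × ℝ} (y : Bool) (h : s.1 + s.2 = 1) :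
    (updateSegment α s y).1 + (updateSegment α s y).2 = 1 := by
  obtain ⟨l, r⟩ := s
  obtain rfl : r = 1 - l := by simp only at h; linarith
  rcases le_total l (1 / 2) with hl | hl
  · cases y <;>
      simp only [updateSegment, if_true, Bool.true_eq_false, if_false, min_eq_right hl,
        max_eq_right (show l - 1 / 2 ≤ 0 by linarith),
        min_eq_left (show 1 / 2 ≤ 1 - l by linarith),
        max_eq_left (show 0 ≤ 1 - l - 1 / 2 by linarith)] <;> ring
  · cases y <;>
      simp only [updateSegment, if_true, Bool.true_eq_false, if_false, min_eq_left hl,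
        max_eq_left (show 0 ≤ l - 1 / 2 by linarith),
        min_eq_right (show 1 - l ≤ 1 / 2 by linarith),
        max_eq_right (show 1 - l - 1 / 2 ≤ 0 by linarith)] <;> ring

lemma orbit_of_add_eq_one (α : ℝ) {s : ℝ × ℝ} (w : ℕ → Bool) (h : s.1 + s.2 = 1) (i : ℕ) :
    (orbit α s w i).1 + (orbit α s w i).2 = 1 := by
  induction i with
  | zero => exact h
  | succ i ih => exact updateSegment_of_add_eq_one α _ ih

/-- On points, an update is one of four maps that are linear in the point and in `α`. -/
lemma updateSegment_fst_cases (α : ℝ) (s : ℝ × ℝ) (y : Bool) :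
    (updateSegment α s y).1 = (2 - α) * s.1 ∨ (updateSegment α s y).1 = α * s.1 ∨
    (updateSegment α s y).1 = 1 - α * (1 - s.1) ∨
    (updateSegment α s y).1 = 1 - (2 - α) * (1 - s.1) := by
  rcases le_total s.1 (1 / 2) with hl | hl
  · cases y <;>
      simp only [updateSegment, if_true, Bool.true_eq_false, if_false, min_eq_right hl,
        max_eq_right (show s.1 - 1 / 2 ≤ 0 by linarith)]
    · left; ring
    · right; left; ring
  · cases y <;>
      simp only [updateSegment, if_true, Bool.true_eq_false, if_false, min_eq_left hl,
        max_eq_left (show 0 ≤ s.1 - 1 / 2 by linarith)]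
    · right; right; left; ring
    · right; right; right; ring

/-! ### Transcendence and the return of the point `1/2` -/

open Polynomial in
lemma natDegree_one_sub {p : ℚ[X]} (h : 0 < p.natDegree) :
    (1 - p).natDegree = p.natDegree := by
  apply natDegree_sub_eq_right_of_natDegree_lt
  simpa using h

open Polynomial in
lemma natDegree_two_sub_X : (2 - X : ℚ[X]).natDegree = 1 := by
  have : (2 - X : ℚ[X]) = C (-1) * X + C 2 := by
    rw [C_neg, C_1, show (C 2 : ℚ[X]) = 2 from rfl]; ring
  rw [this]
  exact natDegree_linear (by norm_num)

open Polynomial in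
/-- The orbit of the point `1/2` consists of values at `α` of rational polynomials of strictly
increasing degree. -/
lemma exists_polynomial_orbit_half (α : ℝ) (w : ℕ → Bool) (k : ℕ) :
    ∃ p : ℚ[X], aeval α p = (orbit α (1 / 2, 1 / 2) w k).1 ∧ p ≠ 0 ∧ 1 - p ≠ 0 ∧
      p.natDegree = k ∧ (1 - p).natDegree = k := by
  induction k with
  | zero =>
    refine ⟨C (1 / 2), by simp [orbit], by simp, ?_, natDegree_C _, ?_⟩
    all_goals rw [show (1 : ℚ[X]) - C (1 / 2) = C (1 / 2) by
      rw [← C_1, ← C_sub]; norm_num]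
    · simp
    · exact natDegree_C _
  | succ k ih =>
    obtain ⟨p, hp, h1, h2, h3, h4⟩ := ih
    have hX : (2 - X : ℚ[X]) ≠ 0 := fun h => by
      have := natDegree_two_sub_X
      rw [h] at this; simp at this
    -- The next step may multiply either `p` or `1 - p` by `X` or `2 - X`, so the degrees of both
    -- are tracked.
    have aux : ∀ q : ℚ[X], q.natDegree = k + 1 →
        q ≠ 0 ∧ 1 - q ≠ 0 ∧ q.natDegree = k + 1 ∧ (1 - q).natDegree = k + 1 := by
      intro q hq
      have hq' : (1 - q).natDegree = k + 1 := by rw [natDegree_one_sub (by omega), hq]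
      refine ⟨?_, ?_, hq, hq'⟩
      · rintro rfl; simp at hq
      · intro h; rw [h] at hq'; simp at hq'
    have aux' : ∀ q : ℚ[X], q.natDegree = k + 1 → 1 - q ≠ 0 ∧ 1 - (1 - q) ≠ 0 ∧
        (1 - q).natDegree = k + 1 ∧ (1 - (1 - q)).natDegree = k + 1 := by
      intro q hq
      obtain ⟨a, b, c, d⟩ := aux q hq
      rw [sub_sub_cancel]
      exact ⟨b, a, d, c⟩
    have h2' : aeval α (2 : ℚ[X]) = 2 := map_ofNat _ 2
    rw [orbit]
    rcases updateSegment_fst_cases α (orbit α (1 / 2, 1 / 2) w k) (w k) with h | h | h | h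
    · exact ⟨(2 - X) * p, by rw [h, ← hp]; simp [h2'], aux _ (by
        rw [natDegree_mul hX h1, natDegree_two_sub_X, h3, add_comm])⟩
    · exact ⟨X * p, by rw [h, ← hp]; simp, aux _ (by
        rw [natDegree_X_mul h1, h3])⟩
    · exact ⟨1 - X * (1 - p), by rw [h, ← hp]; simp, aux' _ (by
        rw [natDegree_X_mul h2, h4])⟩
    · exact ⟨1 - (2 - X) * (1 - p), by rw [h, ← hp]; simp [h2'], aux' _ (by
        rw [natDegree_mul hX h2, natDegree_two_sub_X, h4, add_comm])⟩

open Polynomial in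
lemma orbit_half_ne {α : ℝ} (hα : Transcendental ℚ α) (w : ℕ → Bool) {k : ℕ} (hk : 0 < k) :
    (orbit α (1 / 2, 1 / 2) w k).1 ≠ 1 / 2 := by
  obtain ⟨p, hp, -, -, hd, -⟩ := exists_polynomial_orbit_half α w k
  intro h
  refine hα ⟨p - C (1 / 2), ?_, ?_⟩
  · intro h0
    have := natDegree_sub_C (p := p) (a := (1 / 2 : ℚ))
    rw [h0, hd] at this
    simp at this; omega
  · rw [map_sub, hp, h, aeval_C]; simp

lemma orbit_congr (α : ℝ) (s : ℝ × ℝ) {w w' : ℕ → Bool} {k : ℕ} (h : ∀ j < k, w j = w' j) :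
    orbit α s w k = orbit α s w' k := by
  induction k with
  | zero => rfl
  | succ k ih => rw [orbit, orbit, ih fun j hj => h j (by omega), h k (by omega)]

/-- For transcendental `α`, the point `1/2` does not come back close to itself within a bounded
number of steps. -/
lemma exists_return_gap {α : ℝ} (hα : Transcendental ℚ α) (n : ℕ) :
    ∃ δ > 0, ∀ (w : ℕ → Bool) (k : ℕ), 0 < k → k ≤ n →
      δ < |(orbit α (1 / 2, 1 / 2) w k).1 - 1 / 2| := by
  let ext : (Fin n → Bool) → ℕ → Bool := fun v j => if h : j < n then v ⟨j, h⟩ else false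
  let f : (Fin n → Bool) × Fin n → ℝ := fun p =>
    |(orbit α (1 / 2, 1 / 2) (ext p.1) (p.2 + 1)).1 - 1 / 2|
  have hpos : ∀ p, 0 < f p := fun p =>
    abs_pos.2 (sub_ne_zero.2 (orbit_half_ne hα _ (Nat.succ_pos _)))
  -- Only finitely many words and times matter, so the positive distances have a positive minimum.
  have key : ∃ δ > 0, ∀ p, δ < f p := by
    rcases isEmpty_or_nonempty ((Fin n → Bool) × Fin n) with h | h
    · exact ⟨1, one_pos, fun p => h.elim p⟩
    · obtain ⟨p0, hp0⟩ := Finite.exists_min f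
      exact ⟨f p0 / 2, half_pos (hpos p0), fun p => (half_lt_self (hpos p0)).trans_le (hp0 p)⟩
  obtain ⟨δ, hδ, h⟩ := key
  refine ⟨δ, hδ, fun w k hk hkn => ?_⟩
  have := h (fun j => w j, ⟨k - 1, by omega⟩)
  simp only [f] at this
  rw [Nat.sub_add_cancel hk] at this
  rwa [orbit_congr α _ (w' := w)] at this
  intro j hj
  simp only [ext]
  rw [dif_pos (by omega)]

/-- The segment at time `j` contains the image of the point `1/2` from time `i`. If it straddled
with side ratio at least `1 - δ`, both ends would be within `δ/2` of `1/2`, and so would that image.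
-/
lemma not_straddles_of_return {α δ κ : ℝ} (h0 : 0 < α) (h1 : α < 1) {n : ℕ}
    (hδ0 : 0 < δ) (hδ : ∀ (w : ℕ → Bool) (k : ℕ), 0 < k → k ≤ n →
      δ < |(orbit α (1 / 2, 1 / 2) w k).1 - 1 / 2|)
    (hκ : 1 - δ ≤ κ) {s : ℝ × ℝ} (hs : Proper s) {w : ℕ → Bool} {i j : ℕ} (hij : i < j)
    (hji : j ≤ i + n) (hi : Straddles (orbit α s w i))
    (hj : κ ≤ sideRatio (orbit α s w j)) : ¬ Straddles (orbit α s w j) := by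
  intro hS
  obtain ⟨k, rfl⟩ := Nat.exists_eq_add_of_lt hij
  have hb := half_sideRatio_le_of_straddles (hs.orbit h0 h1 w _) hS hj
  have hi' := max_lt_iff.1 hi
  rw [add_assoc, orbit_add] at hb
  have e1 := orbit_fst_mono h0 h1 (s' := (1 / 2, 1 / 2)) (fun j => w (i + j)) hi'.1.le (k + 1)
  have e2 := orbit_snd_mono h0 h1 (s' := (1 / 2, 1 / 2)) (fun j => w (i + j)) hi'.2.le (k + 1)
  have e3 := orbit_of_add_eq_one α (s := (1 / 2, 1 / 2)) (fun j => w (i + j)) (by norm_num) (k + 1)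
  have e4 := hδ (fun j => w (i + j)) (k + 1) (by omega) (by omega)
  rw [lt_abs] at e4
  rcases e4 with e4 | e4 <;> linarith [hb.1, hb.2]

/-! ### Counting the steps without growth -/

open Classical in
/-- The indices below `i` at which the segment contains `1/2` and a correct symbol is received,
before the side ratio has become small. -/
def stalls (α : ℝ) (s : ℝ × ℝ) (w : ℕ → Bool) (i : ℕ) : Finset ℕ :=
  {j ∈ Finset.range i | Straddles (orbit α s w j) ∧ IsToward (orbit α s w j) (w j) ∧
    α ^ 2 / 16 < sideRatio (orbit α s w j)}

lemma card_le_of_gaps {S : Finset ℕ} {n N : ℕ} (hn : 0 < n) (hS : ∀ i ∈ S, i < N)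
    (hgap : ∀ i ∈ S, ∀ j ∈ S, i < j → i + n < j) : S.card ≤ N / n + 1 := by
  rw [← Finset.card_range (N / n + 1)]
  refine Finset.card_le_card_of_injOn (· / n) ?_ ?_
  · intro i hi
    simp only [Finset.coe_range, Set.mem_Iio]
    exact Nat.lt_succ_of_le (Nat.div_le_div_right (hS i hi).le)
  · intro i hi j hj hij
    simp only at hij
    by_contra hne
    have key : ∀ a b, a + n < b → a / n ≠ b / n := by
      intro a b hab h
      have h1 := Nat.div_add_mod a n
      have h2 := Nat.div_add_mod b n
      rw [h] at h1
      have := Nat.mod_lt b hn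
      omega
    rcases lt_or_gt_of_ne hne with h | h
    · exact key _ _ (hgap i hi j hj h) hij
    · exact key _ _ (hgap j hj i hi h) hij.symm

-- Stalls with side ratio above `4c²` are more than `n` steps apart. Every other stall multiplies
-- the side ratio by `q < 1`, so at most `B` of them fit above `α²/16`.
open Classical in
lemma exists_card_stalls_le {α : ℝ} (h0 : 0 < α) (h1 : α < 1) (hα : 0 ≤ α ^ 2 - 3 * α + 1)
    (htr : Transcendental ℚ α) {n : ℕ} (hn : 0 < n) :
    ∃ B : ℕ, ∀ (s : ℝ × ℝ), Proper s → ∀ (w : ℕ → Bool) (N : ℕ),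
      (stalls α s w N).card ≤ N / n + B := by
  obtain ⟨δ, hδ0, hδ⟩ := exists_return_gap htr n
  set η := min δ 1 / 8 with hη
  have hη0 : 0 < η := by positivity
  have hη1 : η ≤ 1 / 8 := by rw [hη]; gcongr; exact min_le_right _ _
  have hηδ : 8 * η ≤ δ := by rw [hη]; linarith [min_le_left δ 1]
  set c := 1 / 2 - η with hc
  have hκ : 1 - δ ≤ 4 * c ^ 2 := by rw [hc]; nlinarith
  have hα' : α < 3 / 4 := by nlinarith
  -- Equality holds at `c = 1/2`; the difference is `(1 - 2c)(2βc - α)`.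
  have hgt : α < 4 * c * (1 - (2 - α) * c) := by
    have : 0 < (1 - 2 * c) * (2 * (2 - α) * c - α) := by
      apply mul_pos (by linarith); nlinarith
    nlinarith
  have hpos : 0 < 4 * c * (1 - (2 - α) * c) := h0.trans hgt
  set q := max (α * (2 - α)) (α / (4 * c * (1 - (2 - α) * c))) with hq
  have hq0 : 0 < q := lt_max_of_lt_left (mul_pos h0 (by linarith))
  have hq1 : q < 1 := max_lt (by nlinarith) ((div_lt_one hpos).2 hgt)
  have hq2 : α ≤ q * (4 * c * (1 - (2 - α) * c)) := by
    rw [← div_le_iff₀ hpos]; exact le_max_right _ _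
  obtain ⟨B, hB⟩ := exists_pow_lt_of_lt_one (show 0 < α ^ 2 / 16 by positivity) hq1
  refine ⟨B + 1, fun s hs w N => ?_⟩
  set A := {j ∈ stalls α s w N | 4 * c ^ 2 < sideRatio (orbit α s w j)} with hA
  have hAc : A.card ≤ N / n + 1 := by
    refine card_le_of_gaps hn (fun i hi => ?_) (fun i hi j hj hij => ?_)
    · simp only [hA, stalls, Finset.mem_filter, Finset.mem_range] at hi
      exact hi.1.1
    · simp only [hA, stalls, Finset.mem_filter, Finset.mem_range] at hi hj
      by_contra! hle
      exact not_straddles_of_return h0 h1 hδ0 hδ hκ hs hij hle hi.1.2.1 hj.2.le hj.1.2.1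
  have hmid : ∀ i, ({j ∈ stalls α s w i | ¬ 4 * c ^ 2 < sideRatio (orbit α s w j)}).card ≤ B ∧
      sideRatio (orbit α s w i) ≤
        q ^ ({j ∈ stalls α s w i | ¬ 4 * c ^ 2 < sideRatio (orbit α s w j)}).card := by
    intro i
    induction i with
    | zero => simpa [stalls] using sideRatio_le_one (hs.orbit h0 h1 w 0)
    | succ i ih =>
      have hmono : sideRatio (orbit α s w (i + 1)) ≤ sideRatio (orbit α s w i) :=
        sideRatio_update_le h0 h1 (hs.orbit h0 h1 w i) _
      by_cases h : (Straddles (orbit α s w i) ∧ IsToward (orbit α s w i) (w i) ∧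
          α ^ 2 / 16 < sideRatio (orbit α s w i)) ∧ ¬ 4 * c ^ 2 < sideRatio (orbit α s w i)
      · have e : {j ∈ stalls α s w (i + 1) | ¬ 4 * c ^ 2 < sideRatio (orbit α s w j)} =
            insert i {j ∈ stalls α s w i | ¬ 4 * c ^ 2 < sideRatio (orbit α s w j)} := by
          simp only [stalls, Finset.range_add_one, Finset.filter_insert, if_pos h.1, if_pos h.2]
        rw [e, Finset.card_insert_of_notMem (by simp [stalls])]
        constructor
        · have : q ^ B < q ^ ({j ∈ stalls α s w i |
              ¬ 4 * c ^ 2 < sideRatio (orbit α s w j)}).card :=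
            hB.trans (h.1.2.2.trans_le ih.2)
          exact (pow_lt_pow_iff_right_of_lt_one₀ hq0 hq1).1 this
        · rw [pow_succ']
          refine (h.1.2.1.sideRatio_update_le_mul h0 h1 (hs.orbit h0 h1 w i) h.1.1
            (by linarith) (not_lt.1 h.2) (by linarith) (le_max_left _ _) hq2).trans ?_
          exact mul_le_mul_of_nonneg_left ih.2 hq0.le
      · have e : {j ∈ stalls α s w (i + 1) | ¬ 4 * c ^ 2 < sideRatio (orbit α s w j)} =
            {j ∈ stalls α s w i | ¬ 4 * c ^ 2 < sideRatio (orbit α s w j)} := by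
          ext j
          simp only [stalls, Finset.mem_filter, Finset.mem_range]
          constructor
          · rintro ⟨⟨hj, hj'⟩, hj''⟩
            refine ⟨⟨lt_of_le_of_ne (by omega) ?_, hj'⟩, hj''⟩
            rintro rfl
            exact h ⟨hj', hj''⟩
          · rintro ⟨⟨hj, hj'⟩, hj''⟩
            exact ⟨⟨by omega, hj'⟩, hj''⟩
        rw [e]
        exact ⟨ih.1, hmono.trans ih.2⟩
  have hsum : A.card +
      ({j ∈ stalls α s w N | ¬ 4 * c ^ 2 < sideRatio (orbit α s w j)}).card =
      (stalls α s w N).card := by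
    rw [hA]; convert Finset.card_filter_add_card_filter_not _
  have := (hmid N).1
  omega

/-! ### Growth along an orbit -/

-- Growth is recorded by the length until the side ratio reaches `α²/16` and by the potential
-- afterwards; monotonicity of the side ratio makes the switch irreversible.
open Classical in
lemma orbit_growth {α : ℝ} (h0 : 0 < α) (h1 : α < 1) (hα : 0 ≤ α ^ 2 - 3 * α + 1)
    {s : ℝ × ℝ} (hs : Proper s) (w : ℕ → Bool) (err : ℕ → Prop) (N : ℕ)
    (hgood : ∀ j < N, ¬ err j → IsToward (orbit α s w j) (w j))
    (hbad : ∀ j < N, err j → IsAway (orbit α s w j) (w j)) :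
    ∀ i ≤ N,
      (α ^ 2 / 16 < sideRatio (orbit α s w i) ∧
        Real.log (segLength s) + i * Real.log (2 - α)
          - ({j ∈ Finset.range i | err j}).card * (Real.log (2 - α) - Real.log α)
          - (stalls α s w i).card * Real.log (2 - α)
          ≤ Real.log (segLength (orbit α s w i))) ∨
      (sideRatio (orbit α s w i) ≤ α ^ 2 / 16 ∧
        Real.log (α / (2 * (2 - α))) + Real.log (segLength s) + i * Real.log (2 - α)
          - ({j ∈ Finset.range i | err j}).card * (Real.log (2 - α) - Real.log α)
          - (stalls α s w i).card * Real.log (2 - α)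
          ≤ Real.log (latePotential α (orbit α s w i))) := by
  have hb : 0 < 2 - α := by linarith
  have hγ : 0 < α / (2 * (2 - α)) := by positivity
  have hlen : ∀ {s}, Proper s → 0 < segLength s := fun h => by
    unfold segLength; linarith [h.2.2.1]
  have hlate : ∀ {s}, Proper s →
      Real.log (α / (2 * (2 - α))) + Real.log (segLength s) ≤ Real.log (latePotential α s) := by
    intro s h
    rw [← Real.log_mul hγ.ne' (hlen h).ne']
    exact Real.log_le_log (mul_pos hγ (hlen h)) (le_latePotential h0 h1 h)
  have hlatepos : ∀ {s}, Proper s → 0 < latePotential α s := fun h =>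
    (mul_pos hγ (hlen h)).trans_le (le_latePotential h0 h1 h)
  intro i
  induction i with
  | zero =>
    intro _
    simp only [orbit, stalls]
    rcases lt_or_ge (α ^ 2 / 16) (sideRatio s) with h | h
    · left; exact ⟨h, by simp⟩
    · right; exact ⟨h, by simpa using hlate hs⟩
  | succ i ih =>
    intro hi
    have hP := hs.orbit h0 h1 w i
    have hP' := hs.orbit h0 h1 w (i + 1)
    have hmono : sideRatio (orbit α s w (i + 1)) ≤ sideRatio (orbit α s w i) :=
      sideRatio_update_le h0 h1 hP _
    have hcardE : ({j ∈ Finset.range (i + 1) | err j}).card =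
        ({j ∈ Finset.range i | err j}).card + if err i then 1 else 0 := by
      rw [Finset.range_add_one, Finset.filter_insert]
      split_ifs <;> simp
    have hlogb : 0 ≤ Real.log (2 - α) := Real.log_nonneg (by linarith)
    have hS_mono : ((stalls α s w i).card : ℝ) ≤ (stalls α s w (i + 1)).card := by
      exact_mod_cast Finset.card_le_card (Finset.filter_subset_filter _ (by simp))
    have hSlog := mul_le_mul_of_nonneg_right hS_mono hlogb
    have step : ∀ {c x x' : ℝ}, 0 < c → 0 < x → c * x ≤ x' →
        Real.log c + Real.log x ≤ Real.log x' := by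
      intro c x x' hc hx h
      rw [← Real.log_mul hc.ne' hx.ne']
      exact Real.log_le_log (mul_pos hc hx) h
    rcases ih (by omega) with ⟨hK, ih⟩ | ⟨hK, ih⟩
    · have hx : Real.log (segLength s) + (i + 1 : ℕ) * Real.log (2 - α)
          - ({j ∈ Finset.range (i + 1) | err j}).card * (Real.log (2 - α) - Real.log α)
          - (stalls α s w (i + 1)).card * Real.log (2 - α)
          ≤ Real.log (segLength (orbit α s w (i + 1))) := by
        rw [hcardE]
        push_cast
        by_cases he : err i
        · have := step h0 (hlen hP) ((hbad i (by omega) he).segLength_le_update h1 hP)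
          rw [if_pos he]
          rw [orbit]
          linarith
        · have ht := hgood i (by omega) he
          rw [if_neg he]
          by_cases hS : Straddles (orbit α s w i)
          · have := Real.log_le_log (hlen hP) (ht.segLength_le_update h1 hP hS)
            have e : stalls α s w (i + 1) = insert i (stalls α s w i) := by
              simp only [stalls, Finset.range_add_one, Finset.filter_insert,
                if_pos (show _ ∧ _ ∧ _ from ⟨hS, ht, hK⟩)]
            rw [e, Finset.card_insert_of_notMem (by simp [stalls]), orbit]
            push_cast
            linarith
          · have := step hb (hlen hP) (ht.segLength_update hP hS).ge
            rw [orbit]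
            linarith
      rcases lt_or_ge (α ^ 2 / 16) (sideRatio (orbit α s w (i + 1))) with h | h
      · exact Or.inl ⟨h, hx⟩
      · refine Or.inr ⟨h, ?_⟩
        linarith [hlate hP']
    · refine Or.inr ⟨hmono.trans hK, ?_⟩
      rw [hcardE]
      push_cast
      by_cases he : err i
      · have := step h0 (hlatepos hP)
          ((hbad i (by omega) he).mul_latePotential_le h0 h1 hα hP hK)
        rw [if_pos he, orbit]
        linarith
      · have := step hb (hlatepos hP)
          ((hgood i (by omega) he).mul_latePotential_le h0 h1 hα hP hK)
        rw [if_neg he, orbit]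
        linarith

open Classical in
/-- A segment that is not too short contains `1/2` at the end, whatever the errors are. -/
theorem exists_straddles_orbit {α : ℝ} (h0 : 0 < α) (h1 : α < 1) (hα : 0 ≤ α ^ 2 - 3 * α + 1)
    (htr : Transcendental ℚ α) {ε : ℝ} (hε : 0 < ε) :
    ∃ C : ℝ, ∀ (s : ℝ × ℝ), Proper s → ∀ (w : ℕ → Bool) (err : ℕ → Prop) (N : ℕ),
      (∀ j < N, ¬ err j → IsToward (orbit α s w j) (w j)) →
      (∀ j < N, err j → IsAway (orbit α s w j) (w j)) →
      0 < Real.log (segLength s) + N * Real.log (2 - α)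
        - ({j ∈ Finset.range N | err j}).card * (Real.log (2 - α) - Real.log α) - ε * N - C →
      Straddles (orbit α s w N) := by
  have hlogb : 0 < Real.log (2 - α) := Real.log_pos (by linarith)
  -- With this `n`, losing a factor `β` at `N / n` stalls costs at most `ε N`.
  obtain ⟨n, hn⟩ := exists_nat_gt (Real.log (2 - α) / ε)
  have hn0 : (0 : ℝ) < n := (div_pos hlogb hε).trans hn
  obtain ⟨B, hB⟩ := exists_card_stalls_le h0 h1 hα htr (n := n) (by exact_mod_cast hn0)
  refine ⟨B * Real.log (2 - α) - Real.log (α / (2 * (2 - α))), ?_⟩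
  intro s hs w err N hgood hbad h
  by_contra hS
  have hc : ((stalls α s w N).card : ℝ) * Real.log (2 - α) ≤ ε * N + B * Real.log (2 - α) := by
    have e1 : ((stalls α s w N).card : ℝ) ≤ N / n + B := by
      refine le_trans (Nat.cast_le.2 (hB s hs w N)) ?_
      push_cast
      gcongr
      exact Nat.cast_div_le
    have e2 : (N / n : ℝ) * Real.log (2 - α) ≤ ε * N := by
      rw [div_lt_iff₀ hε] at hn
      rw [div_mul_eq_mul_div, div_le_iff₀ hn0]
      nlinarith [(Nat.cast_nonneg N : (0 : ℝ) ≤ N)]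
    nlinarith
  have hP := hs.orbit h0 h1 w N
  have hγ : Real.log (α / (2 * (2 - α))) ≤ 0 := by
    apply Real.log_nonpos
    · exact div_nonneg h0.le (by linarith)
    · rw [div_le_one (by linarith)]; linarith
  have hlen : 0 < segLength (orbit α s w N) := by unfold segLength; linarith [hP.2.2.1]
  -- Both recorded quantities are at most 1 if `1/2` is not interior, so neither logarithm can be
  -- positive.
  rcases orbit_growth h0 h1 hα hs w err N hgood hbad N le_rfl with ⟨-, hg⟩ | ⟨-, hg⟩
  · have : Real.log (segLength (orbit α s w N)) ≤ 0 := by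
      apply Real.log_nonpos hlen.le
      unfold segLength; linarith [hP.1, hP.2.1]
    linarith
  · have : Real.log (latePotential α (orbit α s w N)) ≤ 0 := by
      apply Real.log_nonpos
      · refine le_trans ?_ (le_latePotential h0 h1 hP)
        exact mul_nonneg (div_nonneg h0.le (by linarith)) hlen.le
      · linarith [latePotential_le_half (α := α) hS]
    linarith

/-! ### The number of messages of the algorithm -/

/-- The word `y`, continued by zeros. -/
def extendWord {n : ℕ} (y : Fin n → Bool) (j : ℕ) : Bool := if h : j < n then y ⟨j, h⟩ else false

lemma segmentAfter_take (α : ℝ) (M : ℕ) (m : Fin M) {n : ℕ} (y : Fin n → Bool) {i : ℕ}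
    (hi : i ≤ n) :
    segmentAfter α M m ((List.ofFn y).take i) =
      orbit α (initSegment M m) (extendWord y) i := by
  induction i with
  | zero => simp [segmentAfter, orbit]
  | succ i ih =>
    have h : i < (List.ofFn y).length := by simpa using hi
    rw [List.take_succ_eq_append_getElem h, orbit, ← ih (by omega)]
    simp [segmentAfter, extendWord, show i < n by omega]

lemma segmentAfter_ofFn (α : ℝ) (M : ℕ) (m : Fin M) {n : ℕ} (y : Fin n → Bool) :
    segmentAfter α M m (List.ofFn y) = orbit α (initSegment M m) (extendWord y) n := by
  rw [← segmentAfter_take α M m y le_rfl, List.take_of_length_le (by simp)]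

lemma isToward_algorithmEncoder {α : ℝ} {M : ℕ} {m : Fin M} {ys : List Bool} :
    IsToward (segmentAfter α M m ys) (algorithmEncoder α M m ys) := by
  unfold algorithmEncoder IsToward
  simp only
  split_ifs with h
  · left; exact ⟨rfl, by linarith⟩
  · right; exact ⟨rfl, by linarith⟩

lemma isAway_of_ne_algorithmEncoder {α : ℝ} {M : ℕ} {m : Fin M} {ys : List Bool} {y : Bool}
    (hy : algorithmEncoder α M m ys ≠ y) : IsAway (segmentAfter α M m ys) y := by
  obtain rfl : y = !algorithmEncoder α M m ys := by
    revert hy; cases y <;> cases algorithmEncoder α M m ys <;> simp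
  rcases isToward_algorithmEncoder (α := α) (m := m) (ys := ys) with ⟨h, h'⟩ | ⟨h, h'⟩
  · left; exact ⟨by rw [h]; rfl, h'⟩
  · right; exact ⟨by rw [h]; rfl, h'⟩

lemma proper_initSegment {M : ℕ} (hM : 2 ≤ M) (m : Fin M) : Proper (initSegment M m) := by
  have h2 : (2 : ℝ) ≤ M := by exact_mod_cast hM
  have h3 : (m : ℝ) + 1 ≤ M := by exact_mod_cast m.2
  have h4 : (0 : ℝ) ≤ m := Nat.cast_nonneg _
  have hM0 : (0 : ℝ) < M := by linarith
  have e : (m : ℝ) / M + ((M : ℝ) - 1 - m) / M = 1 - 1 / M := by field_simp; ring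
  refine ⟨div_nonneg h4 hM0.le, div_nonneg (by linarith) hM0.le, ?_, ?_⟩
  · simp only [initSegment]; rw [e]
    have : (0 : ℝ) < 1 / M := by positivity
    linarith
  · simp only [initSegment]; rw [e]
    have : (1 : ℝ) / M ≤ 1 / 2 := by gcongr
    linarith

lemma segLength_initSegment {M : ℕ} (hM : 0 < M) (m : Fin M) :
    segLength (initSegment M m) = 1 / M := by
  have : (M : ℝ) ≠ 0 := by positivity
  simp only [segLength, initSegment]; field_simp; ring

/-- A segment with `1/2` in its interior is the only segment that contains `1/2`. -/
lemma containsHalf_iff_of_straddles {α : ℝ} (h0 : 0 < α) (h1 : α < 1) {M : ℕ} {m : Fin M}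
    {n : ℕ} {y : Fin n → Bool}
    (hS : Straddles (orbit α (initSegment M m) (extendWord y) n)) (j : Fin M) :
    ContainsHalf α M j (List.ofFn y) ↔ j = m := by
  have hS' := max_lt_iff.1 hS
  have hM : (0 : ℝ) < M := by exact_mod_cast m.pos
  simp only [ContainsHalf, Set.mem_Icc, segmentAfter_ofFn]
  constructor
  · rintro ⟨hl, hr⟩
    by_contra hne
    rcases lt_or_gt_of_ne hne with h | h
    · have h' : (j : ℝ) + 1 ≤ m := by exact_mod_cast h
      -- The left end of the segment of `m`, followed as a point, separates it from all earlier
      -- segments.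
      have e1 := orbit_snd_mono h0 h1 (s := ((initSegment M m).1, 1 - (initSegment M m).1))
        (s' := initSegment M j) (extendWord y) (by
          simp only [initSegment]
          rw [one_sub_div hM.ne', div_le_div_iff_of_pos_right hM]; linarith) n
      have e2 := orbit_of_add_eq_one α (s := ((initSegment M m).1, 1 - (initSegment M m).1))
        (extendWord y) (by ring) n
      have e3 := orbit_fst_mono h0 h1 (s := ((initSegment M m).1, 1 - (initSegment M m).1))
        (s' := initSegment M m) (extendWord y) le_rfl n
      linarith [hS'.1]
    · have h' : (m : ℝ) + 1 ≤ j := by exact_mod_cast h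
      have e1 := orbit_fst_mono h0 h1 (s := (1 - (initSegment M m).2, (initSegment M m).2))
        (s' := initSegment M j) (extendWord y) (by
          simp only [initSegment]
          rw [one_sub_div hM.ne']; gcongr; linarith) n
      have e2 := orbit_of_add_eq_one α (s := (1 - (initSegment M m).2, (initSegment M m).2))
        (extendWord y) (by ring) n
      have e3 := orbit_snd_mono h0 h1 (s := (1 - (initSegment M m).2, (initSegment M m).2))
        (s' := initSegment M m) (extendWord y) le_rfl n
      linarith [hS'.2]
  · rintro rfl
    exact ⟨hS'.1.le, by linarith [hS'.2]⟩

/-- The only segment is all of `[0, 1]`, which is not `Proper`. This case keeps every maximum at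
least 1 and its logarithm nonnegative. -/
lemma algorithmSucceeds_one (n t : ℕ) (α : ℝ) : AlgorithmSucceeds n t α 1 := by
  intro m y _ j
  have h : ∀ ys : List Bool, segmentAfter α 1 j ys = (0, 0) := by
    intro ys
    have h1 : initSegment 1 j = (0, 0) := by simp [initSegment, Subsingleton.elim j 0]
    have h2 : ∀ y, updateSegment α (0, 0) y = (0, 0) := by
      intro y; cases y <;> simp [updateSegment]
    rw [segmentAfter, h1]
    induction ys with
    | nil => rfl
    | cons a l ih => rw [List.foldl_cons, h2, ih]
  obtain rfl : j = m := Subsingleton.elim _ _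
  simp only [ContainsHalf, h, iff_true]
  norm_num

open Classical in
lemma exists_algorithmSucceeds {α : ℝ} (h0 : 0 < α) (h1 : α < 1) (hα : 0 ≤ α ^ 2 - 3 * α + 1)
    (htr : Transcendental ℚ α) {ε : ℝ} (hε : 0 < ε) :
    ∃ C : ℝ, ∀ n t M : ℕ, 2 ≤ M →
      Real.log M + ε * n + C < n * Real.log (2 - α) - t * (Real.log (2 - α) - Real.log α) →
      AlgorithmSucceeds n t α M := by
  obtain ⟨C, hC⟩ := exists_straddles_orbit h0 h1 hα htr hε
  refine ⟨C, fun n t M hM h m y hy j => ?_⟩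
  obtain ⟨err, herr⟩ : ∃ err : ℕ → Prop, ∀ j, err j ↔ ∃ h : j < n,
    sentWord (algorithmEncoder α M m) y ⟨j, h⟩ ≠ y ⟨j, h⟩ := ⟨_, fun _ => Iff.rfl⟩
  refine containsHalf_iff_of_straddles h0 h1
    (hC _ (proper_initSegment hM m) (extendWord y) err n ?_ ?_ ?_) j
  · intro j hj he
    simp only [herr, not_exists, not_not] at he
    have := he hj
    rw [← segmentAfter_take α M m y hj.le, extendWord, dif_pos hj, ← this]
    exact isToward_algorithmEncoder
  · intro j hj he
    obtain ⟨_, he⟩ := (herr j).1 he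
    rw [← segmentAfter_take α M m y hj.le, extendWord, dif_pos hj]
    exact isAway_of_ne_algorithmEncoder he
  · have hcard : ({j ∈ Finset.range n | err j}).card ≤ t := by
      refine le_trans ?_ hy
      rw [hammingDist, ← Finset.card_map Fin.valEmbedding]
      apply Finset.card_le_card
      intro j hj
      simp only [Finset.mem_filter, Finset.mem_range] at hj
      obtain ⟨hj, he⟩ := hj
      obtain ⟨_, he⟩ := (herr j).1 he
      exact Finset.mem_map.2 ⟨⟨j, hj⟩, by simpa using he, rfl⟩
    have hD : 0 ≤ Real.log (2 - α) - Real.log α :=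
      sub_nonneg.2 (Real.log_le_log h0 (by linarith))
    have hcard' : (({j ∈ Finset.range n | err j}).card : ℝ) ≤ t := by exact_mod_cast hcard
    have := mul_le_mul_of_nonneg_right hcard' hD
    rw [segLength_initSegment (by omega), one_div, Real.log_inv]
    linarith

/-! ### The Hamming bound with feedback -/

/-- The positions of the errors when `y` is received. -/
def errorPattern (c : List Bool → Bool) {n : ℕ} (y : Fin n → Bool) : Finset (Fin n) :=
  {i | sentWord c y i ≠ y i}

/-- The strategy and the error positions determine the received word symbol by symbol. -/
lemma errorPattern_injective (c : List Bool → Bool) (n : ℕ) :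
    Function.Injective (errorPattern c : (Fin n → Bool) → Finset (Fin n)) := by
  intro y y' h
  have key : ∀ k (hk : k < n), y ⟨k, hk⟩ = y' ⟨k, hk⟩ := by
    intro k
    induction k using Nat.strong_induction_on with
    | _ k ih =>
      intro hk
      have hs : sentWord c y ⟨k, hk⟩ = sentWord c y' ⟨k, hk⟩ := by
        unfold sentWord
        congr 1
        apply List.ext_getElem
        · simp
        · intro i h1 h2
          simp only [List.length_take, List.length_ofFn, lt_min_iff] at h1
          simpa using ih i h1.1 h1.2
      have := Finset.ext_iff.1 h ⟨k, hk⟩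
      simp only [errorPattern, Finset.mem_filter, Finset.mem_univ, true_and, hs] at this
      revert this
      cases sentWord c y' ⟨k, hk⟩ <;> cases y ⟨k, hk⟩ <;> cases y' ⟨k, hk⟩ <;> simp
  exact funext fun i => key i i.2

lemma errorPattern_bijective (c : List Bool → Bool) (n : ℕ) :
    Function.Bijective (errorPattern c : (Fin n → Bool) → Finset (Fin n)) :=
  (Fintype.bijective_iff_injective_and_card _).2 ⟨errorPattern_injective c n, by simp⟩

/-- The Hamming bound for codes with feedback. -/
lemma Transmittable.mul_choose_le {n t M : ℕ} (h : Transmittable n t M) :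
    M * n.choose t ≤ 2 ^ n := by
  obtain ⟨enc, dec, hdec⟩ := h
  let inv : Fin M → Finset (Fin n) → (Fin n → Bool) := fun m S =>
    Function.surjInv (errorPattern_bijective (enc m) n).2 S
  have hinv : ∀ m S, errorPattern (enc m) (inv m S) = S := fun m S =>
    Function.surjInv_eq (errorPattern_bijective (enc m) n).2 S
  have key : ((Finset.univ : Finset (Fin M)) ×ˢ
      Finset.powersetCard t (Finset.univ : Finset (Fin n))).card ≤
      (Finset.univ : Finset (Fin n → Bool)).card := by
    refine Finset.card_le_card_of_injOn (fun p => inv p.1 p.2) (fun _ _ => by simp) ?_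
    have hd : ∀ p ∈ ((Finset.univ : Finset (Fin M)) ×ˢ
        Finset.powersetCard t (Finset.univ : Finset (Fin n))), dec (inv p.1 p.2) = p.1 := by
      intro p hp
      apply hdec
      have := (Finset.mem_powersetCard.1 (Finset.mem_product.1 hp).2).2
      rw [← hinv p.1 p.2] at this
      exact this.le
    rintro ⟨m, S⟩ hp ⟨m', S'⟩ hp' he
    have e1 := hd _ hp
    have e2 := hd _ hp'
    simp only at he e1 e2
    obtain rfl : m = m' := by rw [← e1, ← e2, he]
    rw [← hinv m S, he, hinv]
  simpa [Finset.card_product] using key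

lemma Transmittable.le_two_pow {n t M : ℕ} (h : Transmittable n t M) : M ≤ 2 ^ n := by
  obtain ⟨enc, dec, hdec⟩ := h
  exact Transmittable.mul_choose_le (t := 0) ⟨enc, dec, fun m y hy =>
    hdec m y (le_trans hy (Nat.zero_le t))⟩ |>.trans' (by simp)

lemma bddAbove_transmittable (n t : ℕ) : BddAbove {M : ℕ | Transmittable n t M} :=
  ⟨2 ^ n, fun _ h => h.le_two_pow⟩

lemma AlgorithmSucceeds.transmittable {n t : ℕ} {α : ℝ} {M : ℕ} (hM : 0 < M)
    (h : AlgorithmSucceeds n t α M) : Transmittable n t M := by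
  classical
  refine ⟨algorithmEncoder α M, fun y =>
    if hj : ∃ j, ContainsHalf α M j (List.ofFn y) then hj.choose else ⟨0, hM⟩, fun m y hy => ?_⟩
  have hj : ∃ j, ContainsHalf α M j (List.ofFn y) := ⟨m, (h m y hy m).2 rfl⟩
  simp only
  rw [dif_pos hj]
  exact (h m y hy _).1 hj.choose_spec

lemma bddAbove_algorithmSucceeds (n t : ℕ) (α : ℝ) :
    BddAbove {M : ℕ | AlgorithmSucceeds n t α M} := by
  refine ⟨2 ^ n, fun M h => ?_⟩
  rcases Nat.eq_zero_or_pos M with rfl | hM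
  · exact Nat.zero_le _
  · exact (h.transmittable hM).le_two_pow

lemma one_le_algorithmMaxMessages (n t : ℕ) (α : ℝ) : 1 ≤ algorithmMaxMessages n t α :=
  le_csSup (bddAbove_algorithmSucceeds n t α) (algorithmSucceeds_one n t α)

lemma algorithmMaxMessages_le_maxMessages (n t : ℕ) (α : ℝ) :
    algorithmMaxMessages n t α ≤ maxMessages n t := by
  refine le_csSup (bddAbove_transmittable n t) ?_
  exact AlgorithmSucceeds.transmittable (one_le_algorithmMaxMessages n t α)
    (Nat.sSup_mem ⟨1, algorithmSucceeds_one n t α⟩ (bddAbove_algorithmSucceeds n t α))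

lemma maxMessages_mul_choose_le (n t : ℕ) : maxMessages n t * n.choose t ≤ 2 ^ n := by
  refine Transmittable.mul_choose_le (Nat.sSup_mem (s := {M : ℕ | Transmittable n t M}) ⟨1, ?_⟩
    (bddAbove_transmittable n t))
  exact (algorithmSucceeds_one n t 0).transmittable one_pos

/-- The lower bound for the number of messages of the algorithm. -/
theorem exists_le_log_algorithmMaxMessages {α : ℝ} (h0 : 0 < α) (h1 : α < 1)
    (hα : 0 ≤ α ^ 2 - 3 * α + 1) (htr : Transcendental ℚ α) {ε : ℝ} (hε : 0 < ε) :
    ∃ C : ℝ, ∀ n t : ℕ,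
      n * Real.log (2 - α) - t * (Real.log (2 - α) - Real.log α) - ε * n - C ≤
        Real.log (algorithmMaxMessages n t α) := by
  obtain ⟨C, hC⟩ := exists_algorithmSucceeds h0 h1 hα htr hε
  -- The 1 makes the inequality strict; `log 2` pays for rounding `exp X` down to an integer.
  refine ⟨C + 1 + Real.log 2, fun n t => ?_⟩
  set X := n * Real.log (2 - α) - t * (Real.log (2 - α) - Real.log α) - ε * n - (C + 1) with hX
  suffices h : X - Real.log 2 ≤ Real.log (algorithmMaxMessages n t α) by linarith
  have hpos : 0 ≤ Real.log (algorithmMaxMessages n t α) :=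
    Real.log_nonneg (by exact_mod_cast one_le_algorithmMaxMessages n t α)
  rcases le_or_gt X (Real.log 2) with hX0 | hX0
  · linarith
  · have he : 2 < Real.exp X := by
      rwa [← Real.log_lt_iff_lt_exp (by norm_num)]
    have hM : 2 ≤ ⌊Real.exp X⌋₊ := Nat.le_floor (by exact_mod_cast he.le)
    have hM' : (⌊Real.exp X⌋₊ : ℝ) ≤ Real.exp X := Nat.floor_le (Real.exp_pos X).le
    have hMpos : (0 : ℝ) < ⌊Real.exp X⌋₊ := by exact_mod_cast (by omega : 0 < ⌊Real.exp X⌋₊)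
    have hs : AlgorithmSucceeds n t α ⌊Real.exp X⌋₊ := by
      apply hC n t _ hM
      have := Real.log_le_log hMpos hM'
      rw [Real.log_exp] at this
      linarith
    have hle : ⌊Real.exp X⌋₊ ≤ algorithmMaxMessages n t α :=
      le_csSup (bddAbove_algorithmSucceeds n t α) hs
    have hle' : Real.exp X / 2 ≤ ⌊Real.exp X⌋₊ := by
      have := Nat.lt_floor_add_one (Real.exp X)
      linarith
    have : Real.log (Real.exp X / 2) ≤ Real.log (algorithmMaxMessages n t α) :=
      Real.log_le_log (by positivity) (hle'.trans (by exact_mod_cast hle))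
    rwa [Real.log_div (Real.exp_ne_zero _) (by norm_num), Real.log_exp] at this

/-! ### Upper bounds -/

/-- The most probable value of a binomial distribution is close to its mean, so that it has
probability at least `(1 - p) / (n + 1)`. -/
lemma le_choose_mul_pow {p : ℝ} (hp0 : 0 < p) (hp1 : p < 1) {n t : ℕ} (ht : (t : ℝ) ≤ p * n)
    (ht' : p * n < t + 1) :
    (1 - p) / (n + 1) ≤ n.choose t * (p ^ t * (1 - p) ^ (n - t)) := by
  have hq : 0 < 1 - p := by linarith
  have hn0 : (0 : ℝ) ≤ n := Nat.cast_nonneg n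
  have htn : t ≤ n := by
    have : (t : ℝ) ≤ n := by nlinarith
    exact_mod_cast this
  let a : ℕ → ℝ := fun i => n.choose i * (p ^ i * (1 - p) ^ (n - i))
  have ha : ∀ i, 0 ≤ a i := fun i => by positivity
  have hrec : ∀ i < n, a (i + 1) * ((i + 1) * (1 - p)) = a i * ((n - i) * p) := by
    intro i hi
    have h1 : (n.choose (i + 1) : ℝ) * (i + 1) = n.choose i * (n - i) := by
      rw [← Nat.cast_sub hi.le]
      exact_mod_cast Nat.choose_succ_right_eq n i
    have h2 : (1 - p) ^ (n - i) = (1 - p) ^ (n - (i + 1)) * (1 - p) := by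
      rw [← pow_succ]; congr 1; omega
    simp only [a]
    rw [h2, pow_succ]
    linear_combination (p ^ i * p * (1 - p) ^ (n - (i + 1)) * (1 - p)) * h1
  have hup : ∀ i < t, a i ≤ a (i + 1) := by
    intro i hi
    have hi' : (i : ℝ) + 1 ≤ t := by exact_mod_cast hi
    have hc : 0 < ((i : ℝ) + 1) * (1 - p) := by positivity
    refine le_of_mul_le_mul_right ?_ hc
    rw [hrec i (by omega)]
    exact mul_le_mul_of_nonneg_left (by nlinarith) (ha i)
  have hdown : ∀ i, t < i → i < n → a (i + 1) ≤ a i := by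
    intro i hi hin
    have hi' : (t : ℝ) + 1 ≤ i := by exact_mod_cast hi
    have hc : 0 < ((i : ℝ) + 1) * (1 - p) := by positivity
    refine le_of_mul_le_mul_right ?_ hc
    rw [hrec i hin]
    exact mul_le_mul_of_nonneg_left (by nlinarith) (ha i)
  have hle : ∀ i ≤ t, a i ≤ a t := fun i hi =>
    Nat.le_induction (P := fun k _ => k ≤ t → a i ≤ a k) (fun _ => le_rfl)
      (fun k _ ih hk => (ih (by omega)).trans (hup k (by omega))) t hi le_rfl
  have hge : ∀ i, t + 1 ≤ i → i ≤ n → a i ≤ a (t + 1) := fun i hi =>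
    Nat.le_induction (P := fun k _ => k ≤ n → a k ≤ a (t + 1)) (fun _ => le_rfl)
      (fun k hk ih hkn => (hdown k (by omega) (by omega)).trans (ih (by omega))) i hi
  -- The largest term is at `t` or `t + 1`, and `p n < t + 1` bounds the second by the first over `1
  -- - p`.
  have hall : ∀ i ≤ n, a i * (1 - p) ≤ a t := by
    intro i hi
    rcases le_or_gt i t with h | h
    · nlinarith [hle i h, ha i, ha t]
    · have h1 := hge i h hi
      have h2 : a (t + 1) * (1 - p) ≤ a t := by
        have hc : (0 : ℝ) < t + 1 := by positivity
        refine le_of_mul_le_mul_right ?_ hc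
        have := hrec t (by omega)
        have h3 : a t * ((n - t) * p) ≤ a t * (t + 1) := by
          refine mul_le_mul_of_nonneg_left ?_ (ha t)
          nlinarith [(Nat.cast_nonneg t : (0 : ℝ) ≤ t)]
        nlinarith
      nlinarith
  have hsum : ∑ i ∈ Finset.range (n + 1), a i = 1 := by
    have := add_pow p (1 - p) n
    rw [add_sub_cancel, one_pow] at this
    rw [this]
    exact Finset.sum_congr rfl fun i _ => by simp only [a]; ring
  rw [div_le_iff₀ (by positivity)]
  calc 1 - p = ∑ i ∈ Finset.range (n + 1), a i * (1 - p) := by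
        rw [← Finset.sum_mul, hsum, one_mul]
    _ ≤ ∑ i ∈ Finset.range (n + 1), a t :=
        Finset.sum_le_sum fun i hi => hall i (by simpa [Nat.lt_succ_iff] using hi)
    _ = a t * (n + 1) := by simp [mul_comm]

/-- With `p = α/2`, the factor `2 ^ n p ^ t (1 - p) ^ (n - t)` is `α ^ t β ^ (n - t)`, the main term
of the lower bound. -/
lemma log_maxMessages_le {α : ℝ} (h0 : 0 < α) (h1 : α < 1) {n t : ℕ}
    (ht : (t : ℝ) ≤ α / 2 * n) (ht' : α / 2 * n < t + 1) :
    Real.log (maxMessages n t) ≤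
      n * Real.log (2 - α) - t * (Real.log (2 - α) - Real.log α) + Real.log (n + 1)
        - Real.log (1 - α / 2) := by
  have htn : t ≤ n := by
    have : (t : ℝ) ≤ n := by nlinarith [(Nat.cast_nonneg n : (0 : ℝ) ≤ n)]
    exact_mod_cast this
  have hM : (0 : ℝ) < maxMessages n t := by
    exact_mod_cast (one_le_algorithmMaxMessages n t α).trans
      (algorithmMaxMessages_le_maxMessages n t α)
  have hb : 0 < 2 - α := by linarith
  have hq : 0 < 1 - α / 2 := by linarith
  have hc := le_choose_mul_pow (p := α / 2) (by linarith) (by linarith) ht ht'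
  have hH : (maxMessages n t : ℝ) * n.choose t ≤ 2 ^ n := by
    exact_mod_cast maxMessages_mul_choose_le n t
  have key : (maxMessages n t : ℝ) * ((1 - α / 2) / (n + 1)) ≤ α ^ t * (2 - α) ^ (n - t) := by
    calc (maxMessages n t : ℝ) * ((1 - α / 2) / (n + 1))
        ≤ maxMessages n t * (n.choose t * ((α / 2) ^ t * (1 - α / 2) ^ (n - t))) := by gcongr
      _ = maxMessages n t * n.choose t * ((α / 2) ^ t * (1 - α / 2) ^ (n - t)) := by ring
      _ ≤ 2 ^ n * ((α / 2) ^ t * (1 - α / 2) ^ (n - t)) := by gcongr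
      _ = α ^ t * (2 - α) ^ (n - t) := by
        rw [show (2 : ℝ) ^ n = 2 ^ t * 2 ^ (n - t) by rw [← pow_add]; congr 1; omega,
          mul_mul_mul_comm, ← mul_pow, ← mul_pow]
        congr 2 <;> ring
  have := Real.log_le_log (by positivity) key
  rw [Real.log_mul hM.ne' (by positivity), Real.log_div hq.ne' (by positivity),
    Real.log_mul (by positivity) (by positivity), Real.log_pow, Real.log_pow,
    Nat.cast_sub htn] at this
  linarith

/-! ### Linear asymptotics and the rate -/

lemma exists_log_succ_le {ε : ℝ} (hε : 0 < ε) :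
    ∃ C : ℝ, ∀ n : ℕ, Real.log (n + 1) ≤ ε * n + C := by
  refine ⟨ε - 1 - Real.log ε, fun n => ?_⟩
  have h : (0 : ℝ) < n + 1 := by positivity
  have := Real.log_le_sub_one_of_pos (mul_pos hε h)
  rw [Real.log_mul hε.ne' h.ne'] at this
  linarith

lemma isLittleO_of_forall_le {f : ℕ → ℝ}
    (hf : ∀ ε > 0, ∃ C : ℝ, ∀ n : ℕ, |f n| ≤ ε * n + C) :
    f =o[atTop] (fun n : ℕ => (n : ℝ)) := by
  rw [isLittleO_iff]
  intro c hc
  obtain ⟨C, hC⟩ := hf (c / 2) (half_pos hc)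
  filter_upwards [tendsto_natCast_atTop_atTop.eventually_ge_atTop (C / (c / 2))] with n hn
  rw [div_le_iff₀ (half_pos hc)] at hn
  rw [Real.norm_eq_abs, Real.norm_of_nonneg (Nat.cast_nonneg n)]
  linarith [hC n]

lemma tendsto_div_of_isLittleO {f : ℕ → ℝ} {c : ℝ}
    (h : (fun n : ℕ => f n - n * c) =o[atTop] (fun n : ℕ => (n : ℝ))) :
    Tendsto (fun n : ℕ => f n / n) atTop (𝓝 c) := by
  have := h.tendsto_div_nhds_zero.add_const c
  rw [zero_add] at this
  refine this.congr' ?_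
  filter_upwards [eventually_gt_atTop 0] with n hn
  have : (n : ℝ) ≠ 0 := by positivity
  field_simp
  ring

/-- The rate of the channel in the range in which the Hamming bound is attained. -/
theorem maxRate_eq {α : ℝ} (h0 : 0 < α) (h1 : α < 1) (hα : 0 ≤ α ^ 2 - 3 * α + 1)
    (htr : Transcendental ℚ α) :
    maxRate (α / 2) =
      (Real.log (2 - α) - α / 2 * (Real.log (2 - α) - Real.log α)) / Real.log 2 := by
  set D := Real.log (2 - α) - Real.log α with hD
  have hD0 : 0 ≤ D := sub_nonneg.2 (Real.log_le_log h0 (by linarith))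
  have key : (fun n : ℕ => Real.log (maxMessages n ⌊α / 2 * n⌋₊) -
      n * (Real.log (2 - α) - α / 2 * D)) =o[atTop] (fun n : ℕ => (n : ℝ)) := by
    apply isLittleO_of_forall_le
    intro ε hε
    obtain ⟨C, hC⟩ := exists_le_log_algorithmMaxMessages h0 h1 hα htr hε
    obtain ⟨C', hC'⟩ := exists_log_succ_le hε
    refine ⟨max C (C' + D - Real.log (1 - α / 2)), fun n => ?_⟩
    have hfl : (⌊α / 2 * n⌋₊ : ℝ) ≤ α / 2 * n := Nat.floor_le (by positivity)
    have hlt : α / 2 * n < (⌊α / 2 * n⌋₊ : ℝ) + 1 := Nat.lt_floor_add_one _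
    have e1 := mul_le_mul_of_nonneg_right hfl hD0
    have e2 := mul_le_mul_of_nonneg_right hlt.le hD0
    rw [abs_le]
    constructor
    · have h2 : Real.log (algorithmMaxMessages n ⌊α / 2 * n⌋₊ α) ≤
          Real.log (maxMessages n ⌊α / 2 * n⌋₊) :=
        Real.log_le_log (by exact_mod_cast one_le_algorithmMaxMessages _ _ _)
          (by exact_mod_cast algorithmMaxMessages_le_maxMessages _ _ _)
      have := le_max_left C (C' + D - Real.log (1 - α / 2))
      linarith [hC n ⌊α / 2 * n⌋₊]
    · have := le_max_right C (C' + D - Real.log (1 - α / 2))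
      linarith [log_maxMessages_le h0 h1 hfl hlt, hC' n]
  have hlim := (tendsto_div_of_isLittleO key).div_const (Real.log 2)
  unfold maxRate
  refine Tendsto.limsup_eq (hlim.congr fun n => ?_)
  rw [Real.logb]
  ring

/-! ### The algorithm with `⌊n(1+τ)⌋` symbols and `⌊τn⌋` errors -/

lemma floor_mul_one_add {τ : ℝ} (hτ : 0 < τ) (n : ℕ) :
    ⌊(n : ℝ) * (1 + τ)⌋₊ = n + ⌊τ * n⌋₊ := by
  rw [show (n : ℝ) * (1 + τ) = τ * n + (n : ℕ) by ring, Nat.floor_add_natCast (by positivity),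
    add_comm]

/-- Each unit of `k` contributes `-log (αβ) ≥ 0`. The constant does not depend on `k`, as the
minimum requires. -/
lemma exists_le_logMessages {α τ : ℝ} (h0 : 0 < α) (h1 : α < 1) (hα : 0 ≤ α ^ 2 - 3 * α + 1)
    (htr : Transcendental ℚ α) (hτ0 : 0 < τ) (hτ1 : τ ≤ 1) {ε : ℝ} (hε : 0 < ε) :
    ∃ C : ℝ, ∀ n k : ℕ, k ≤ ⌊τ * n⌋₊ →
      n * ((Real.log (2 - α) + τ * Real.log α) / Real.log 2) - (ε * n + C) ≤
        logMessages α τ n k := by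
  have hl2 : 0 < Real.log 2 := Real.log_pos (by norm_num)
  obtain ⟨C, hC⟩ := exists_le_log_algorithmMaxMessages h0 h1 hα htr
    (show 0 < ε * Real.log 2 / 2 by positivity)
  refine ⟨C / Real.log 2, fun n k hk => ?_⟩
  have hfl : (⌊τ * n⌋₊ : ℝ) ≤ τ * n := Nat.floor_le (by positivity)
  have htn : ⌊τ * n⌋₊ ≤ n := by
    have : (⌊τ * n⌋₊ : ℝ) ≤ n := by nlinarith [(Nat.cast_nonneg n : (0 : ℝ) ≤ n)]
    exact_mod_cast this
  rw [logMessages, floor_mul_one_add hτ0, Real.logb]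
  have h := hC (n + ⌊τ * n⌋₊ - 2 * k) (⌊τ * n⌋₊ - k)
  rw [Nat.cast_sub hk, Nat.cast_sub (by omega)] at h
  push_cast at h
  have hlα : Real.log α ≤ 0 := Real.log_nonpos h0.le h1.le
  have hk0 : (0 : ℝ) ≤ k := Nat.cast_nonneg k
  have htn' : (⌊τ * n⌋₊ : ℝ) ≤ n := by exact_mod_cast htn
  have hab : Real.log (2 - α) + Real.log α ≤ 0 := by
    rw [← Real.log_mul (by linarith) h0.ne']
    apply Real.log_nonpos <;> nlinarith
  have e1 := mul_le_mul_of_nonpos_right hfl hlα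
  have e2 := mul_nonneg hk0 (neg_nonneg.2 hab)
  have e3 : ε * Real.log 2 / 2 * ((n : ℝ) + ⌊τ * n⌋₊ - 2 * k) ≤ ε * Real.log 2 / 2 * (2 * n) := by
    gcongr; linarith
  rw [le_div_iff₀ hl2]
  have e4 : (n * ((Real.log (2 - α) + τ * Real.log α) / Real.log 2) - (ε * n + C / Real.log 2)) *
      Real.log 2 = n * (Real.log (2 - α) + τ * Real.log α) - ε * n * Real.log 2 - C := by
    field_simp; ring
  rw [e4]
  linarith

lemma exists_logMessages_zero_le {α τ : ℝ} (h0 : 0 < α) (h1 : α < 1)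
    (hτ0 : 0 < τ) (hτ1 : τ ≤ 1) (hατ : α = 2 * τ / (1 + τ)) {ε : ℝ} (hε : 0 < ε) :
    ∃ C : ℝ, ∀ n : ℕ, logMessages α τ n 0 ≤
      n * ((Real.log (2 - α) + τ * Real.log α) / Real.log 2) + (ε * n + C) := by
  have hl2 : 0 < Real.log 2 := Real.log_pos (by norm_num)
  obtain ⟨C, hC⟩ := exists_log_succ_le (show 0 < ε * Real.log 2 / 2 by positivity)
  refine ⟨(C - Real.log α - Real.log (1 - α / 2)) / Real.log 2, fun n => ?_⟩
  have hn0 : (0 : ℝ) ≤ n := Nat.cast_nonneg n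
  have hfl : (⌊τ * n⌋₊ : ℝ) ≤ τ * n := Nat.floor_le (by positivity)
  have hlt : τ * n < (⌊τ * n⌋₊ : ℝ) + 1 := Nat.lt_floor_add_one _
  have hα2 : α / 2 = τ / (1 + τ) := by rw [hατ]; ring
  rw [logMessages, floor_mul_one_add hτ0, Real.logb]
  simp only [mul_zero, tsub_zero]
  have h2 : Real.log (algorithmMaxMessages (n + ⌊τ * n⌋₊) ⌊τ * n⌋₊ α) ≤
      Real.log (maxMessages (n + ⌊τ * n⌋₊) ⌊τ * n⌋₊) :=
    Real.log_le_log (by exact_mod_cast one_le_algorithmMaxMessages _ _ _)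
      (by exact_mod_cast algorithmMaxMessages_le_maxMessages _ _ _)
  have h3 := log_maxMessages_le h0 h1 (n := n + ⌊τ * n⌋₊) (t := ⌊τ * n⌋₊)
    (by rw [hα2, div_mul_eq_mul_div, le_div_iff₀ (by linarith)]; push_cast; nlinarith)
    (by
      rw [hα2, div_mul_eq_mul_div, div_lt_iff₀ (by linarith)]; push_cast; nlinarith)
  have h4 := hC (n + ⌊τ * n⌋₊)
  push_cast at h3 h4
  have hlα : Real.log α ≤ 0 := Real.log_nonpos h0.le h1.le
  have e1 := mul_le_mul_of_nonpos_right hlt.le hlα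
  have e3 : ε * Real.log 2 / 2 * ((n : ℝ) + ⌊τ * n⌋₊) ≤ ε * Real.log 2 / 2 * (2 * n) := by
    gcongr; nlinarith
  rw [div_le_iff₀ hl2]
  have e4 : (n * ((Real.log (2 - α) + τ * Real.log α) / Real.log 2) +
      (ε * n + (C - Real.log α - Real.log (1 - α / 2)) / Real.log 2)) * Real.log 2 =
      n * (Real.log (2 - α) + τ * Real.log α) + ε * n * Real.log 2 +
        (C - Real.log α - Real.log (1 - α / 2)) := by
    field_simp
    ring
  rw [e4]
  linarith

/-- Strict convexity of `x log x` at `α` and `β`, whose mean is 1. A positive rate is what allows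
division in the `1 + o(1)` statement. -/
lemma log_add_mul_log_pos {α τ : ℝ} (h0 : 0 < α) (h1 : α < 1) (hτ : α = τ * (2 - α)) :
    0 < Real.log (2 - α) + τ * Real.log α := by
  have hb : 0 < 2 - α := by linarith
  have h := Real.strictConvexOn_mul_log.2 (Set.mem_Ici.2 h0.le) (Set.mem_Ici.2 hb.le)
    (by linarith) (show (0 : ℝ) < 1 / 2 by norm_num) (show (0 : ℝ) < 1 / 2 by norm_num)
    (by norm_num)
  simp only [smul_eq_mul] at h
  rw [show 1 / 2 * α + 1 / 2 * (2 - α) = 1 by ring, Real.log_one] at h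
  have : 0 < (2 - α) * (Real.log (2 - α) + τ * Real.log α) := by
    have : (2 - α) * (Real.log (2 - α) + τ * Real.log α) =
        (2 - α) * Real.log (2 - α) + (τ * (2 - α)) * Real.log α := by ring
    rw [this, ← hτ]; linarith
  exact pos_of_mul_pos_right this hb.le

end FeedbackCoding

end

theorem mainTheorem6 (α τ : ℝ) (hτ_pos : 0 < τ)
    (hα : Transcendental ℚ α) (hτ : Transcendental ℚ τ)
    (hατ : α = 2 * τ / (1 + τ)) (hα_le : α ≤ (3 - Real.sqrt 5) / 2) :
    (∃ ε : ℕ → ℝ, Tendsto ε atTop (𝓝 0) ∧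
      ∀ᶠ n : ℕ in atTop,
        FeedbackCoding.minLogMessages α τ n
          = (1 + ε n) * FeedbackCoding.logMessages α τ n 0) ∧
    (fun n : ℕ => FeedbackCoding.logMessages α τ n 0
        - n * (1 + τ) * FeedbackCoding.maxRate (τ / (1 + τ)))
      =o[atTop] (fun n : ℕ => (n : ℝ)) ∧
    (fun n : ℕ => FeedbackCoding.minLogMessages α τ n
        - n * (1 + τ) * FeedbackCoding.maxRate (τ / (1 + τ)))
      =o[atTop] (fun n : ℕ => (n : ℝ)) := by
  have h0 : 0 < α := by rw [hατ]; positivity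
  have h5 : 2 ≤ Real.sqrt 5 := Real.le_sqrt_of_sq_le (by norm_num)
  have h1 : α < 1 := by linarith
  have hgold : 0 ≤ α ^ 2 - 3 * α + 1 := by
    have := Real.sq_sqrt (show (0 : ℝ) ≤ 5 by norm_num)
    nlinarith
  have hτb : α = τ * (2 - α) := by rw [hατ]; field_simp; ring
  have hτ1 : τ ≤ 1 := by
    by_contra! h
    nlinarith
  have hl2 : 0 < Real.log 2 := Real.log_pos (by norm_num)
  set c := (Real.log (2 - α) + τ * Real.log α) / Real.log 2 with hc
  have hc0 : 0 < c := div_pos (FeedbackCoding.log_add_mul_log_pos h0 h1 hτb) hl2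
  have hrate : ∀ n : ℕ, (n : ℝ) * (1 + τ) * FeedbackCoding.maxRate (τ / (1 + τ)) = n * c := by
    intro n
    have hα2 : τ / (1 + τ) = α / 2 := by rw [hατ]; ring
    rw [hα2, FeedbackCoding.maxRate_eq h0 h1 hgold hα, hc, ← hα2]
    field_simp
    ring
  have hmin : ∀ n, FeedbackCoding.minLogMessages α τ n ≤ FeedbackCoding.logMessages α τ n 0 :=
    fun n => Finset.inf'_le _ (by simp)
  have hO : ∀ f : ℕ → ℝ, (∀ n, FeedbackCoding.minLogMessages α τ n ≤ f n) →
      (∀ n, f n ≤ FeedbackCoding.logMessages α τ n 0) →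
      (fun n : ℕ => f n - n * c) =o[atTop] (fun n : ℕ => (n : ℝ)) := by
    intro f hf hf'
    apply FeedbackCoding.isLittleO_of_forall_le
    intro ε hε
    obtain ⟨C, hC⟩ := FeedbackCoding.exists_le_logMessages h0 h1 hgold hα hτ_pos hτ1 hε
    obtain ⟨C', hC'⟩ := FeedbackCoding.exists_logMessages_zero_le h0 h1 hτ_pos hτ1 hατ hε
    refine ⟨max C C', fun n => abs_le.2 ⟨?_, ?_⟩⟩
    · have : n * c - (ε * n + C) ≤ FeedbackCoding.minLogMessages α τ n :=
        Finset.le_inf' _ _ fun k hk =>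
          hC n k (Nat.lt_succ_iff.1 (Finset.mem_range.1 hk))
      linarith [le_max_left C C', hf n]
    · linarith [le_max_right C C', hf' n, hC' n]
  have hO0 := hO _ hmin fun n => le_rfl
  have hO1 := hO _ (fun n => le_rfl) hmin
  refine ⟨⟨fun n => FeedbackCoding.minLogMessages α τ n / FeedbackCoding.logMessages α τ n 0 - 1,
    ?_, ?_⟩, by simpa only [hrate] using hO0, by simpa only [hrate] using hO1⟩
  · have t0 := FeedbackCoding.tendsto_div_of_isLittleO hO0
    have t1 := FeedbackCoding.tendsto_div_of_isLittleO hO1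
    have := (t1.div t0 hc0.ne').sub_const 1
    rw [div_self hc0.ne', sub_self] at this
    refine this.congr' ?_
    filter_upwards [eventually_gt_atTop 0] with n hn
    have : (n : ℝ) ≠ 0 := by positivity
    simp only [Pi.div_apply]
    rw [div_div_div_cancel_right₀ this]
  · have t0 := FeedbackCoding.tendsto_div_of_isLittleO hO0
    filter_upwards [t0.eventually (lt_mem_nhds hc0)] with n hn
    have : FeedbackCoding.logMessages α τ n 0 ≠ 0 := by
      intro h; simp [h] at hn
    field_simp
    ring
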